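/- Let $(W,S)$ be a Coxeter system with $S$ finite, Coxeter matrix $m$ and length function $\ell$, and let $J\subseteq S$. Let $W^J$ be the set of $w\in W$ such that $\ell(ws)>\ell(w)$ for all $s\in J$ (the minimal-length representatives of the left cosets of $W_J$), partially ordered by the restriction of the Bruhat order; $\vartriangleleft$ denotes covering in $W^J$. The Coxeter graph has node set $S$ and an edge between $s$ and $t$ whenever $m(s,t)\ge 3$ (including $\infty$); $(W,S)$ is irreducible if this graph is connected, and simply-laced if $m(s,t)\in\{2,3\}$ for all $s\neq t$. The bw-Coxeter graph of $(W,W_J)$ is the Coxeter graph with the nodes in $J$ coloured white and all others black. An element $w\in W^J$ is *chainlike* if it covers exactly one element $w'$ of $W^J$, and $w'$ is either the least element $e$ or, inductively, chainlike; $C(W^J)$ is the set of chainlike elements. An element $w\in W^J$ is *simple* if $w=s_k\cdots s_1s_0$ for some $k\ge 0$ and distinct $s_0,\dots,s_k\in S$ with $s_0\in S\setminus J$, $s_1,\dots,s_k\in J$, and, for all $i,j$, $m(s_i,s_j)\ge 3$ if and only if $|i-j|=1$. For $u,v\in W^J$ put $L(u,v)=\min\{\ell(w): w\in W^J,\ u\le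 w,\ v\le w\}$, and for $u,v\in C(W^J)$ write $u\sim v$ if $L(u,v)=L(u',v)=L(u,v')$. For every $w\in W^J$ the length $\ell(w)$ is the height of $w$ in the poset $W^J$ (the supremum of the lengths of strict chains ending at $w$), so that all of these notions except simplicity depend only on the poset $W^J$. **Theorem.** (a) Every simple $w\in W^J$ is chainlike. (b) If $(W,S)$ is simply-laced, then $w\in W^J$ is simple if and only if it is chainlike, and $\sim$ is an equivalence relation on $C(W^J)$. (c) If $(W,S)$ is simply-laced and irreducible and $J\ne S$, then the following construction on the poset $W^J$ produces the bw-Coxeter graph of $(W,W_J)$: 1. Draw a node for every equivalence class of $\sim$, and colour it black if the class contains an element of length $1$, and white otherwise. 2. Connect the nodes of two distinct classes $U,V$ by an edge exactly when there are $u\in U$, $v\in V$ such that either $u=v'$ or $v=u'$, or else $u'=v'$ and there are exactly two elements of $W^J$ that cover both $u$ and $v$. More precisely, there is an isomorphism $\varphi$ from the constructed graph to the Coxeter graph such that a class $U$ is black if and only if $\varphi(U)\notin J$, and for every $u\in C(W^J)$ the class $[u]$ is sent to the leftmost generator of $u$, that is, $u=\varphi([u])\,u'$. -/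

import Mathlib

/-! ### Coxeter graphs -/

/-- The Coxeter graph: `s` and `t` are joined when `m(s,t) ≥ 3`.
Mathlib encodes `m(s,t) = ∞` as `M s t = 0`. -/
def CoxeterMatrix.coxeterGraph {B : Type*} (M : CoxeterMatrix B) : SimpleGraph B where
  Adj s t := M s t = 0 ∨ 3 ≤ M s t
  symm := ⟨fun s t h => by rwa [M.symmetric t s]⟩
  loopless := ⟨fun s h => by simp at h⟩

/-- Simply-laced: `m(s,t) ∈ {2,3}` for all distinct `s`, `t`. -/
def CoxeterMatrix.SimplyLaced {B : Type*} (M : CoxeterMatrix B) : Prop :=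
  ∀ s t : B, s ≠ t → M s t = 2 ∨ M s t = 3

/-- Irreducible: the Coxeter graph is connected. -/
def CoxeterMatrix.IsIrreducible {B : Type*} (M : CoxeterMatrix B) : Prop :=
  M.coxeterGraph.Connected

/-! ### The Bruhat order and the poset `W^J` -/

section Bruhat

variable {B W : Type*} [Group W] {M : CoxeterMatrix B} (cs : CoxeterSystem M W)

/-- One step up in the Bruhat order: `v = u * t` for a reflection `t`, with `ℓ(u) < ℓ(v)`. -/
def CoxeterSystem.BruhatStep (u v : W) : Prop :=
  ∃ t : W, cs.IsReflection t ∧ v = u * t ∧ cs.length u < cs.length v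

/-- The Bruhat order `u ≤ v`: there are reflections `t₁, …, tₙ` (`n ≥ 0`) with `v = u t₁ ⋯ tₙ`
and strictly increasing lengths along the partial products. -/
def CoxeterSystem.BruhatLE (u v : W) : Prop :=
  Relation.ReflTransGen cs.BruhatStep u v

theorem CoxeterSystem.BruhatLE.eq_or_length_lt {cs : CoxeterSystem M W} {u v : W}
    (h : cs.BruhatLE u v) : u = v ∨ cs.length u < cs.length v := by
  induction h with
  | refl => exact Or.inl rfl
  | tail _ hstep ih =>
    obtain ⟨t, _, _, hlt⟩ := hstep
    rcases ih with rfl | ih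
    · exact Or.inr hlt
    · exact Or.inr (ih.trans hlt)

/-- The set `W^J` of elements without right descents in `J`, that is, the elements none of whose
reduced expressions ends in a generator from `J` (the minimal representatives of `W / W_J`). -/
def CoxeterSystem.MinRep (J : Set B) : Type _ :=
  {w : W // ∀ j ∈ J, ¬ cs.IsRightDescent w j}

/-- `W^J` carries the restriction of the Bruhat order. -/
instance CoxeterSystem.MinRep.instPartialOrder (J : Set B) : PartialOrder (cs.MinRep J) where
  le u v := cs.BruhatLE u.1 v.1
  le_refl u := Relation.ReflTransGen.refl
  le_trans u v w h₁ h₂ := Relation.ReflTransGen.trans h₁ h₂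
  le_antisymm u v h₁ h₂ := by
    rcases CoxeterSystem.BruhatLE.eq_or_length_lt h₁ with h | h
    · exact Subtype.ext h
    · rcases CoxeterSystem.BruhatLE.eq_or_length_lt h₂ with h' | h'
      · exact Subtype.ext h'.symm
      · exact absurd (h.trans h') (lt_irrefl _)

/-- `w ∈ W^J` is simple if `w = s_k ⋯ s_1 s_0` with `s_0, …, s_k` distinct, `s_0 ∉ J`,
`s_1, …, s_k ∈ J`, and `m(s_i,s_j) ≥ 3` exactly when `|i - j| = 1`. -/
def CoxeterSystem.MinRep.IsSimple {cs : CoxeterSystem M W} {J : Set B} (w : cs.MinRep J) : Prop :=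
  ∃ (k : ℕ) (s : Fin (k + 1) → B),
    Function.Injective s ∧
    s 0 ∉ J ∧ (∀ i, i ≠ 0 → s i ∈ J) ∧
    (∀ i j, M.coxeterGraph.Adj (s i) (s j) ↔ ((i : ℕ) + 1 = j ∨ (j : ℕ) + 1 = i)) ∧
    w.1 = cs.wordProd (List.ofFn s).reverse

end Bruhat

/-! ### The construction, for an arbitrary poset

Everything in this section only uses the order. The length of an element is its height
`Order.height`, the supremum of the lengths of the strict chains that end at it. -/

section Construction

variable {P : Type*} [PartialOrder P]

/-- `w` is chainlike if it covers exactly one element `u`, and `u` is the least element or is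
itself chainlike. -/
inductive IsChainlike : P → Prop
  | base {u w : P} (hcov : u ⋖ w) (huniq : ∀ v, v ⋖ w → v = u) (hbot : IsBot u) : IsChainlike w
  | step {u w : P} (hcov : u ⋖ w) (huniq : ∀ v, v ⋖ w → v = u) (hu : IsChainlike u) :
      IsChainlike w

variable (P) in
/-- The set of chainlike elements of `P`, as a type. -/
abbrev Chainlikes : Type _ := {w : P // IsChainlike w}

/-- `L(u,v)`: the least length of a common upper bound of `u` and `v`. -/
noncomputable def minUpperLength (u v : P) : ℕ∞ :=
  ⨅ (w : P) (_ : u ≤ w) (_ : v ≤ w), Order.height w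

/-- `u ∼ v` if `L(u,v) = L(u',v) = L(u,v')`, where `x'` is the unique element covered by a
chainlike `x`. -/
def ChainSim (u v : Chainlikes P) : Prop :=
  ∃ u' v' : P, u' ⋖ u.1 ∧ v' ⋖ v.1 ∧
    minUpperLength u.1 v.1 = minUpperLength u' v.1 ∧
    minUpperLength u' v.1 = minUpperLength u.1 v'

variable (P) in
/-- The nodes of the constructed graph: the `∼`-classes of chainlike elements. -/
abbrev ChainNode : Type _ := Quot (ChainSim (P := P))

variable (P) in
/-- The constructed graph. Distinct classes `U`, `V` are joined if there are `u ∈ U`, `v ∈ V` with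
`u = v'` or `v = u'` (for chainlike elements: one covers the other), or with `u' = v'` and exactly
two elements of `P` covering both `u` and `v`. -/
def chainGraph : SimpleGraph (ChainNode P) where
  Adj U V := U ≠ V ∧ ∃ u v : Chainlikes P, Quot.mk _ u = U ∧ Quot.mk _ v = V ∧
    (u.1 ⋖ v.1 ∨ v.1 ⋖ u.1 ∨
      ((∃ x : P, x ⋖ u.1 ∧ x ⋖ v.1) ∧ {w : P | u.1 ⋖ w ∧ v.1 ⋖ w}.encard = 2))
  symm := ⟨by
    rintro U V ⟨hne, u, v, hu, hv, h⟩
    refine ⟨hne.symm, v, u, hv, hu, ?_⟩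
    rcases h with h | h | ⟨⟨x, hx₁, hx₂⟩, h⟩
    · exact Or.inr (Or.inl h)
    · exact Or.inl h
    · refine Or.inr (Or.inr ⟨⟨x, hx₂, hx₁⟩, ?_⟩)
      simpa only [and_comm] using h⟩
  loopless := ⟨fun U h => h.1 rfl⟩

/-- A node of the constructed graph is black if its class contains an element of length `1`. -/
def ChainNode.IsBlack (U : ChainNode P) : Prop :=
  ∃ u : Chainlikes P, Quot.mk _ u = U ∧ Order.height u.1 = 1

end Construction

/-! Everything is driven by left descents and the lifting property of the Bruhat order, which
follows from strong exchange. Multiplying by a left descent never leaves `W^J`, while `r x ∉ W^J`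
for `x ∈ W^J` forces `r x = x j` with `j ∈ J` (`IsMinRep.exists_simple_mul_eq`). The dual geometric
representation shows that a generator in `W_I` belongs to `I` and that generators joined in the
Coxeter graph do not commute. Hence, if `r` is not among the distinct letters of `x`, then `r x = x
j` implies `j = r`, and `r` commutes with every letter of `x`.

Simple implies chainlike: let `w = s x` come from a simple word and let `v < w` in `W^J`. If `s` is
not a left descent of `v`, lifting gives `v ≤ x`. Otherwise `s v < x`, and by induction `s v` only
involves letters beyond the second one of the word; these commute with `s`, so `v` would have the
right descent `s ∈ J`. Thus `w` covers `x` alone.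

Chainlike implies simple when `m ≤ 3`: `w` has one left descent `r`, and `w = r s x` with `s x`
simple by induction. Commutation or a braid move would make `s` a second descent, unless `r` is
adjacent to `s` and absent from `x`. If `r x` were in `W^J`, it would be a second element below `w`;
so `r` commutes with `x`, hence with each of its letters.

The relation `∼` compares leftmost generators. Removing a left descent from a minimal common upper
bound of `u` and `v` yields a shorter bound for `u, v`, for `u', v` or for `u, v'`, which excludes
different generators. For equal generators, `exists_upper_of_left_descent` and one step back up give
the required equalities. Finally, paths to a black node supply a simple word for every generator,
and two simple words with a common tail and leftmost letters `s ≠ t` have the two upper covers `s t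
x`, `t s x` exactly when `s` and `t` do not commute. -/

namespace CoxeterSystem

variable {B W : Type*} [Group W] {M : CoxeterMatrix B} (cs : CoxeterSystem M W)

/-! ### The strong exchange property -/

section Exchange

open Classical in
/-- The action of a generator on signed group elements: conjugation, with a change of sign at the
generator itself. -/
noncomputable def signedConj (i : B) : Function.End (W × ZMod 2) :=
  fun p => (cs.simple i * p.1 * cs.simple i, p.2 + if p.1 = cs.simple i then 1 else 0)

-- The sign change counts, modulo 2, the occurrences of the given element in a list of dihedral
-- reflections.
open Classical in
theorem signedConj_mul_pow_apply (i j : B) (n : ℕ) (p : W × ZMod 2) :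
    ((cs.signedConj i * cs.signedConj j) ^ n) p =
      ((cs.simple i * cs.simple j) ^ n * p.1 * (cs.simple j * cs.simple i) ^ n,
        p.2 + ∑ k ∈ Finset.range (2 * n),
          if p.1 = (cs.simple j * cs.simple i) ^ k * cs.simple j then 1 else 0) := by
  have hinv : ∀ k, ((cs.simple i * cs.simple j) ^ k)⁻¹ = (cs.simple j * cs.simple i) ^ k := by
    intro k; rw [← inv_pow, mul_inv_rev, cs.inv_simple, cs.inv_simple]
  have hswap : ∀ k, cs.simple j * (cs.simple i * cs.simple j) ^ k =
      (cs.simple j * cs.simple i) ^ k * cs.simple j := by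
    intro k
    have h : SemiconjBy (cs.simple j) (cs.simple i * cs.simple j)
        (cs.simple j * cs.simple i) := by simp [SemiconjBy, mul_assoc]
    exact h.pow_right k
  induction n with
  | zero => simp [Function.End.one_def]
  | succ n ih =>
    rw [pow_succ']
    change cs.signedConj i (cs.signedConj j (((cs.signedConj i * cs.signedConj j) ^ n) p)) = _
    rw [ih]
    simp only [signedConj]
    -- Applying `j` and then `i` contributes the summands with `k = 2n` and `k = 2n + 1`.
    have h1 : ((cs.simple i * cs.simple j) ^ n * p.1 * (cs.simple j * cs.simple i) ^ n
        = cs.simple j) ↔ p.1 = (cs.simple j * cs.simple i) ^ (2 * n) * cs.simple j := by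
      rw [← eq_mul_inv_iff_mul_eq, ← eq_inv_mul_iff_mul_eq, hinv, ← hinv n, inv_inv, hswap,
        two_mul, pow_add, hinv]
      simp only [mul_assoc]
    have h2 : (cs.simple j * ((cs.simple i * cs.simple j) ^ n * p.1 *
        (cs.simple j * cs.simple i) ^ n) * cs.simple j = cs.simple i) ↔
        p.1 = (cs.simple j * cs.simple i) ^ (2 * n + 1) * cs.simple j := by
      have : ∀ x : W, cs.simple j * x * cs.simple j = cs.simple i ↔
          x = cs.simple j * cs.simple i * cs.simple j := by
        intro x
        constructor
        · intro h; rw [← h]; simp [mul_assoc]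
        · rintro rfl; simp [mul_assoc]
      rw [this, ← eq_mul_inv_iff_mul_eq, ← eq_inv_mul_iff_mul_eq, hinv, ← hinv n, inv_inv,
        mul_assoc (cs.simple j * cs.simple i), hswap, pow_succ, two_mul, pow_add, hinv]
      rw [← mul_assoc (cs.simple j * cs.simple i), ← pow_succ', pow_succ]
      simp only [mul_assoc]
    rw [show 2 * (n + 1) = 2 * n + 1 + 1 by ring, Finset.sum_range_succ, Finset.sum_range_succ]
    refine Prod.ext ?_ ?_
    · simp only
      rw [pow_succ', pow_succ]
      simp only [mul_assoc]
    · simp only [h1, h2]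
      ring

/-- For `n = M i j` the summands for `k` and `k + n` coincide, so all sign changes cancel in pairs.
-/
theorem signedConj_isLiftable : M.IsLiftable cs.signedConj := by
  classical
  intro i j
  have h1 : (cs.simple j * cs.simple i) ^ M i j = 1 := by
    rw [M.symmetric]; exact cs.simple_mul_simple_pow j i
  funext p
  rw [signedConj_mul_pow_apply, cs.simple_mul_simple_pow, h1, two_mul, Finset.sum_range_add]
  simp only [pow_add, h1, one_mul, mul_one]
  rw [CharTwo.add_self_eq_zero]
  simp [Function.End.one_def]

/-- The signed conjugation action of `W`. -/
noncomputable def signedAction : W →* Function.End (W × ZMod 2) :=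
  cs.lift ⟨cs.signedConj, cs.signedConj_isLiftable⟩

theorem signedAction_simple (i : B) : cs.signedAction (cs.simple i) = cs.signedConj i :=
  cs.lift_apply_simple cs.signedConj_isLiftable i

/-- The sign change of `t` under the action of `w⁻¹`. -/
noncomputable def inversionParity (w t : W) : ZMod 2 := (cs.signedAction w⁻¹ (t, 0)).2

theorem signedAction_apply (w : W) (t : W) (e : ZMod 2) :
    cs.signedAction w (t, e) = (w * t * w⁻¹, e + cs.inversionParity w⁻¹ t) := by
  unfold inversionParity
  rw [inv_inv]
  induction w using cs.simple_induction_left generalizing t e with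
  | one => 
    rw [map_one]
    change (t, e) = (_, e + 0)
    simp
  | mul_simple_left w i ih =>
    rw [map_mul, signedAction_simple]
    change cs.signedConj i (cs.signedAction w (t, e)) =
      (_, e + (cs.signedConj i (cs.signedAction w (t, 0))).2)
    rw [ih, ih t 0]
    simp [signedConj, mul_assoc, add_assoc]

theorem inversionParity_mul (x y t : W) :
    cs.inversionParity (x * y) t =
      cs.inversionParity x t + cs.inversionParity y (x⁻¹ * t * x) := by
  conv_lhs => unfold inversionParity
  rw [mul_inv_rev, map_mul]
  change (cs.signedAction y⁻¹ (cs.signedAction x⁻¹ (t, 0))).2 = _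
  rw [signedAction_apply, signedAction_apply]
  simp

open Classical in
theorem inversionParity_simple (i : B) (t : W) :
    cs.inversionParity (cs.simple i) t = if t = cs.simple i then 1 else 0 := by
  simp [inversionParity, signedAction_simple, signedConj]

theorem inversionParity_one (t : W) : cs.inversionParity 1 t = 0 := by
  have := cs.inversionParity_mul 1 1 t
  simpa using this

theorem IsReflection.inversionParity_self {t : W} (ht : cs.IsReflection t) :
    cs.inversionParity t t = 1 := by
  obtain ⟨w, i, rfl⟩ := ht
  have h := cs.inversionParity_mul w w⁻¹ (w * cs.simple i * w⁻¹)
  rw [mul_inv_cancel, inversionParity_one] at h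
  rw [inversionParity_mul, inversionParity_mul, inversionParity_simple]
  have e1 : w⁻¹ * (w * cs.simple i * w⁻¹) * w = cs.simple i := by group
  have e2 : (w * cs.simple i)⁻¹ * (w * cs.simple i * w⁻¹) * (w * cs.simple i) = cs.simple i := by
    group
  rw [e1] at h
  rw [e1, e2, if_pos rfl, add_right_comm, ← h, zero_add]

/-- A nonzero parity means that `t` is one of the reflections attached to the letters of the word;
multiplying by `t` deletes that letter. -/
theorem length_mul_wordProd_lt_of_inversionParity (ω : List B) (t : W)
    (h : cs.inversionParity (cs.wordProd ω) t ≠ 0) :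
    cs.length (t * cs.wordProd ω) < ω.length := by
  classical
  induction ω generalizing t with
  | nil => exact absurd (by simpa using cs.inversionParity_one t) h
  | cons i ω ih =>
    rw [wordProd_cons] at h ⊢
    rw [inversionParity_mul, inversionParity_simple] at h
    by_cases hti : t = cs.simple i
    · subst hti
      rw [simple_mul_simple_cancel_left, List.length_cons]
      exact Nat.lt_succ_of_le (cs.length_wordProd_le ω)
    · rw [if_neg hti, zero_add] at h
      have h1 := ih _ h
      have h2 := cs.length_mul_le (cs.simple i)
        ((cs.simple i)⁻¹ * t * cs.simple i * cs.wordProd ω)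
      rw [length_simple] at h2
      have e : cs.simple i * ((cs.simple i)⁻¹ * t * cs.simple i * cs.wordProd ω) =
          t * (cs.simple i * cs.wordProd ω) := by group
      rw [e] at h2
      simp only [List.length_cons]
      omega

/-- Since `t` has parity 1 at itself, exactly one of `w` and `t * w` has nonzero parity at `t`, and
that one is the longer of the two. -/
theorem IsReflection.inversionParity_ne_zero_iff {t : W} (ht : cs.IsReflection t) (w : W) :
    cs.inversionParity w t ≠ 0 ↔ cs.length (t * w) < cs.length w := by
  have key : ∀ w, cs.inversionParity w t ≠ 0 → cs.length (t * w) < cs.length w := by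
    intro w h
    obtain ⟨ω, hω, rfl⟩ := cs.exists_isReduced w
    rw [hω.eq]
    exact cs.length_mul_wordProd_lt_of_inversionParity ω t h
  refine ⟨key w, fun h h0 => ?_⟩
  have h1 : cs.inversionParity (t * w) t ≠ 0 := by
    rw [inversionParity_mul, ht.inversionParity_self, ht.inv, ht.mul_self, one_mul, h0]
    decide
  have h2 := key _ h1
  rw [← mul_assoc, ht.mul_self, one_mul] at h2
  exact lt_asymm h h2

/-- The strong exchange property, one letter at a time. -/
theorem IsReflection.eq_simple_or_length_lt {t : W} (ht : cs.IsReflection t) (i : B) (x : W)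
    (h : cs.length (t * (cs.simple i * x)) < cs.length (cs.simple i * x)) :
    t = cs.simple i ∨ cs.length (cs.simple i * t * cs.simple i * x) < cs.length x := by
  classical
  by_cases hti : t = cs.simple i
  · exact Or.inl hti
  right
  rw [← ht.inversionParity_ne_zero_iff, inversionParity_mul, inversionParity_simple, if_neg hti,
    zero_add, inv_simple] at h
  have h' : cs.IsReflection (cs.simple i * t * cs.simple i) := by
    simpa using ht.conj (cs.simple i)
  exact (h'.inversionParity_ne_zero_iff cs x).1 h

end Exchange

/-! ### Lifting properties of the Bruhat order -/

section Lifting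

variable {cs}

theorem BruhatLE.trans {u v w : W} (h : cs.BruhatLE u v) (h' : cs.BruhatLE v w) :
    cs.BruhatLE u w := Relation.ReflTransGen.trans h h'

theorem BruhatLE.length_le {u v : W} (h : cs.BruhatLE u v) : cs.length u ≤ cs.length v := by
  rcases h.eq_or_length_lt with rfl | h
  · exact le_rfl
  · exact h.le

theorem bruhatStep_iff_left {u v : W} :
    cs.BruhatStep u v ↔ ∃ t, cs.IsReflection t ∧ v = t * u ∧ cs.length u < cs.length v := by
  constructor
  · rintro ⟨t, ht, rfl, h⟩
    exact ⟨u * t * u⁻¹, ht.conj u, by group, h⟩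
  · rintro ⟨t, ht, rfl, h⟩
    exact ⟨u⁻¹ * t * u, by simpa using ht.conj u⁻¹, by group, h⟩

theorem BruhatStep.inv {u v : W} (h : cs.BruhatStep u v) : cs.BruhatStep u⁻¹ v⁻¹ := by
  obtain ⟨t, ht, rfl, h⟩ := h
  exact bruhatStep_iff_left.2 ⟨t, ht, by rw [mul_inv_rev, ht.inv],
    by simpa only [length_inv] using h⟩

theorem BruhatLE.inv {u v : W} (h : cs.BruhatLE u v) : cs.BruhatLE u⁻¹ v⁻¹ := by
  induction h with
  | refl => exact Relation.ReflTransGen.refl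
  | tail _ h ih => exact ih.tail h.inv

theorem bruhatLE_simple_mul {u : W} {i : B} (h : cs.length u < cs.length (cs.simple i * u)) :
    cs.BruhatLE u (cs.simple i * u) :=
  Relation.ReflTransGen.single (bruhatStep_iff_left.2 ⟨_, cs.isReflection_simple i, rfl, h⟩)

theorem simple_mul_bruhatLE {u : W} {i : B} (h : cs.length (cs.simple i * u) < cs.length u) :
    cs.BruhatLE (cs.simple i * u) u := by
  simpa using bruhatLE_simple_mul (cs := cs) (u := cs.simple i * u) (i := i) (by simpa using h)

/-- By strong exchange, multiplying `u` and `t u` by a generator can reverse their order of lengths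
only if `t` is this generator. -/
theorem BruhatStep.simple_mul {u v : W} (h : cs.BruhatStep u v) (i : B) :
    cs.simple i * u = v ∨ cs.BruhatStep (cs.simple i * u) (cs.simple i * v) := by
  obtain ⟨t, ht, rfl, h⟩ := bruhatStep_iff_left.1 h
  by_cases hti : t = cs.simple i
  · exact Or.inl (by rw [hti])
  right
  have hr : cs.IsReflection (cs.simple i * t * cs.simple i) := by
    simpa using ht.conj (cs.simple i)
  have e : cs.simple i * (t * u) = cs.simple i * t * cs.simple i * (cs.simple i * u) := by
    simp [mul_assoc]
  refine bruhatStep_iff_left.2 ⟨_, hr, e, ?_⟩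
  by_contra hlt
  rw [e] at hlt
  have hlt' := lt_of_le_of_ne (not_lt.1 hlt) (hr.length_mul_right_ne _)
  rcases hr.eq_simple_or_length_lt cs i u hlt' with h1 | h1
  · apply hti
    have := congrArg (fun x => cs.simple i * x * cs.simple i) h1
    simpa [mul_assoc] using this
  · have e2 : cs.simple i * (cs.simple i * t * cs.simple i) * cs.simple i * u = t * u := by
      simp [mul_assoc]
    rw [e2] at h1
    exact lt_asymm h h1

/-- Multiply a chain from `u` to `w` by the generator. Either all steps survive, or some step is
multiplication by the generator itself, and there the new chain joins the old one. -/
theorem BruhatLE.simple_mul_le_or {u w : W} (h : cs.BruhatLE u w) (i : B) :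
    cs.BruhatLE (cs.simple i * u) w ∨ cs.BruhatLE (cs.simple i * u) (cs.simple i * w) := by
  induction h using Relation.ReflTransGen.head_induction_on with
  | refl => exact Or.inr Relation.ReflTransGen.refl
  | head h1 h2 ih =>
    rcases h1.simple_mul i with e | h3
    · exact Or.inl (e ▸ h2)
    · exact ih.imp (Relation.ReflTransGen.head h3) (Relation.ReflTransGen.head h3)

theorem BruhatLE.le_simple_mul_or {u w : W} (h : cs.BruhatLE u w) (i : B) :
    cs.BruhatLE u (cs.simple i * w) ∨ cs.BruhatLE (cs.simple i * u) (cs.simple i * w) := by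
  induction h with
  | refl => exact Or.inr Relation.ReflTransGen.refl
  | tail h1 h2 ih =>
    rcases h2.simple_mul i with e | h3
    · left; rw [← e, simple_mul_simple_cancel_left]; exact h1
    · exact ih.imp (fun h => h.tail h3) (fun h => h.tail h3)

/-- If `u ≤ w` and `s` is a left descent of `w`, then `s u ≤ w`. -/
theorem BruhatLE.simple_mul_le {u w : W} (h : cs.BruhatLE u w) {i : B}
    (hw : cs.IsLeftDescent w i) : cs.BruhatLE (cs.simple i * u) w :=
  (h.simple_mul_le_or i).elim id fun h => h.trans (simple_mul_bruhatLE hw)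

/-- If `u ≤ w` and `s` is not a left descent of `u`, then `u ≤ s w`. -/
theorem BruhatLE.le_simple_mul {u w : W} (h : cs.BruhatLE u w) {i : B}
    (hu : ¬ cs.IsLeftDescent u i) : cs.BruhatLE u (cs.simple i * w) :=
  (h.le_simple_mul_or i).elim id fun h => BruhatLE.trans
    (bruhatLE_simple_mul (lt_of_le_of_ne (not_lt.1 hu) (cs.length_simple_mul_ne u i).symm)) h

/-- If `u ≤ w` and `s` is a left descent of `u`, then `s u ≤ s w`. -/
theorem BruhatLE.simple_mul_le_simple_mul {u w : W} (h : cs.BruhatLE u w) {i : B}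
    (hu : cs.IsLeftDescent u i) : cs.BruhatLE (cs.simple i * u) (cs.simple i * w) :=
  (h.le_simple_mul_or i).elim (fun h => (simple_mul_bruhatLE hu).trans h) id

/-- If `u ≤ w` and `s` is not a left descent of `w`, then `s u ≤ s w`. -/
theorem BruhatLE.simple_mul_le_simple_mul' {u w : W} (h : cs.BruhatLE u w) {i : B}
    (hw : ¬ cs.IsLeftDescent w i) : cs.BruhatLE (cs.simple i * u) (cs.simple i * w) :=
  (h.simple_mul_le_or i).elim (fun h => h.trans
    (bruhatLE_simple_mul (lt_of_le_of_ne (not_lt.1 hw) (cs.length_simple_mul_ne w i).symm))) id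

/-- If `u ≤ w` and `s` is not a right descent of `u`, then `u ≤ w s`. -/
theorem BruhatLE.le_mul_simple {u w : W} (h : cs.BruhatLE u w) {i : B}
    (hu : ¬ cs.IsRightDescent u i) : cs.BruhatLE u (w * cs.simple i) := by
  have := (h.inv.le_simple_mul (i := i) (by rwa [isLeftDescent_inv_iff])).inv
  simpa using this

theorem one_bruhatLE (w : W) : cs.BruhatLE 1 w := by
  induction hn : cs.length w generalizing w with
  | zero => rw [cs.length_eq_zero_iff.1 hn]; exact Relation.ReflTransGen.refl
  | succ n ih =>
    obtain ⟨i, hi⟩ := cs.exists_leftDescent_of_ne_one (w := w)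
      (by rintro rfl; simp at hn)
    have := cs.isLeftDescent_iff.1 hi
    exact (ih _ (by omega)).trans (simple_mul_bruhatLE hi)

theorem eq_one_of_bruhatLE_one {u : W} (h : cs.BruhatLE u 1) : u = 1 := by
  have := h.length_le
  rw [length_one] at this
  exact cs.length_eq_zero_iff.1 (by omega)

end Lifting

end CoxeterSystem

namespace CoxeterSystem

variable {B W : Type*} [Group W] {M : CoxeterMatrix B} (cs : CoxeterSystem M W)

/-! ### The dual geometric representation -/

section DualRepresentation

/-- The Cartan coefficients `-2 cos (π / m(i,j))`. -/
noncomputable def cartanCoeff (M : CoxeterMatrix B) (i j : B) : ℂ :=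
  -(2 * Complex.cos (Real.pi / M i j))

theorem cartanCoeff_self (M : CoxeterMatrix B) (i : B) : cartanCoeff M i i = 2 := by
  simp [cartanCoeff]

theorem cartanCoeff_symm (M : CoxeterMatrix B) (i j : B) :
    cartanCoeff M i j = cartanCoeff M j i := by
  simp [cartanCoeff, M.symmetric i j]

theorem cartanCoeff_ne_zero {M : CoxeterMatrix B} {i j : B} (h : M.coxeterGraph.Adj i j) :
    cartanCoeff M i j ≠ 0 := by
  have key : 0 < Real.cos (Real.pi / M i j) := by
    rcases h with h | h
    -- Division by `0` gives `0`, so the coefficient is `-2`, the usual value for `m = ∞`.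
    · simp [h]
    · have h3 : (3 : ℝ) ≤ M i j := by exact_mod_cast h
      apply Real.cos_pos_of_mem_Ioo
      constructor
      · have : 0 < Real.pi / M i j := by positivity
        linarith [Real.pi_pos]
      · rw [div_lt_div_iff₀ (by linarith) two_pos]
        nlinarith [Real.pi_pos]
  unfold cartanCoeff
  rw [neg_ne_zero]
  refine mul_ne_zero two_ne_zero ?_
  exact_mod_cast key.ne'

/-- The action of a generator in the dual geometric representation. -/
noncomputable def dualReflection (M : CoxeterMatrix B) (i : B) : Module.End ℂ (B → ℂ) where
  toFun f := fun b => f b - f i * cartanCoeff M i b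
  map_add' f g := by ext b; simp; ring
  map_smul' c f := by ext b; simp; ring

theorem dualReflection_apply (i : B) (f : B → ℂ) (b : B) :
    dualReflection M i f b = f b - f i * cartanCoeff M i b := rfl

/-- For `m ≥ 3` the product `T` of two generators is killed by `(X - 1)(X - ζ)(X - ζ⁻¹)` with `ζ =
exp(2πi/m)`. The roots are distinct `m`-th roots of unity, so this polynomial divides `X^m - 1`.
Complex scalars make the factors linear. -/
theorem dualReflection_isLiftable (M : CoxeterMatrix B) : M.IsLiftable (dualReflection M) := by
  intro i j
  by_cases hij : i = j
  · subst hij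
    rw [M.diagonal, pow_one]
    ext f b
    simp only [Module.End.mul_apply, dualReflection_apply, cartanCoeff_self, Module.End.one_apply]
    ring
  have h1 : M i j ≠ 1 := M.off_diagonal i j hij
  rcases Nat.lt_or_ge (M i j) 3 with h3 | h3
  · have : M i j = 0 ∨ M i j = 2 := by omega
    rcases this with h | h
    · rw [h, pow_zero]
    · have e : cartanCoeff M i j = 0 := by
        simp [cartanCoeff, h, Complex.cos_pi_div_two]
      rw [h, pow_two]
      ext f b
      simp only [Module.End.mul_apply, dualReflection_apply, cartanCoeff_self,
        Module.End.one_apply, cartanCoeff_symm M j i, e]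
      ring
  · set m := M i j with hm
    set η : ℂ := Complex.exp (Real.pi / m * Complex.I) with hη
    have hη0 : η ≠ 0 := Complex.exp_ne_zero _
    have ha : cartanCoeff M i j = -(η + η⁻¹) := by
      rw [cartanCoeff, Complex.cos, hη, ← Complex.exp_neg, ← hm]
      ring_nf
    have hm0 : (m : ℂ) ≠ 0 := by exact_mod_cast (by omega : m ≠ 0)
    have hprim : IsPrimitiveRoot (η ^ 2) m := by
      have := Complex.isPrimitiveRoot_exp m (by omega)
      convert this using 1
      rw [hη, ← Complex.exp_nat_mul]
      congr 1
      push_cast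
      field_simp
    set ζ := η ^ 2 with hζ
    have hζ0 : ζ ≠ 0 := pow_ne_zero _ hη0
    set T := dualReflection M i * dualReflection M j with hT
    have hann : (T - 1) * ((T - algebraMap ℂ _ ζ) * (T - algebraMap ℂ _ ζ⁻¹)) = 0 := by
      ext f b
      simp only [hT, Module.End.mul_apply, LinearMap.sub_apply, Module.End.one_apply, Pi.sub_apply,
        dualReflection_apply, Module.algebraMap_end_apply, Pi.smul_apply, smul_eq_mul,
        cartanCoeff_self, cartanCoeff_symm M j i, ha, LinearMap.zero_apply, Pi.zero_apply]
      rw [hζ]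
      field_simp
      ring
    open Polynomial in
    have hdvd : (X - C 1) * ((X - C ζ) * (X - C ζ⁻¹)) ∣ (X ^ m - 1 : ℂ[X]) := by
      have hζ1 : ζ ≠ 1 := hprim.ne_one (by omega)
      have hζi1 : ζ⁻¹ ≠ 1 := fun h => hζ1 (inv_eq_one.1 h)
      have hζζ : ζ ≠ ζ⁻¹ := by
        intro h
        have : ζ ^ 2 = 1 := by rw [pow_two]; nth_rw 2 [h]; exact mul_inv_cancel₀ hζ0
        have := hprim.dvd_of_pow_eq_one _ this
        have := Nat.le_of_dvd two_pos this
        omega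
      have hr : ∀ z : ℂ, z ^ m = 1 → (X - C z) ∣ (X ^ m - 1 : ℂ[X]) := by
        intro z hz
        rw [dvd_iff_isRoot]
        simp [hz]
      refine IsCoprime.mul_dvd (IsCoprime.mul_right ?_ ?_) (hr 1 (one_pow _))
        (IsCoprime.mul_dvd ?_ (hr ζ hprim.pow_eq_one)
          (hr ζ⁻¹ (by rw [inv_pow, hprim.pow_eq_one, inv_one])))
      · exact isCoprime_X_sub_C_of_isUnit_sub (sub_ne_zero.2 hζ1.symm).isUnit
      · exact isCoprime_X_sub_C_of_isUnit_sub (sub_ne_zero.2 hζi1.symm).isUnit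
      · exact isCoprime_X_sub_C_of_isUnit_sub (sub_ne_zero.2 hζζ).isUnit
    obtain ⟨q, hq⟩ := hdvd
    have := congrArg (Polynomial.aeval T) hq
    simp only [map_mul, map_sub, map_pow, Polynomial.aeval_X, Polynomial.aeval_C, map_one] at this
    rw [hann, zero_mul, sub_eq_zero] at this
    exact this

/-- The dual geometric representation. -/
noncomputable def dualRepresentation : W →* Module.End ℂ (B → ℂ) :=
  cs.lift ⟨dualReflection M, dualReflection_isLiftable M⟩

theorem dualRepresentation_simple (i : B) :
    cs.dualRepresentation (cs.simple i) = dualReflection M i :=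
  cs.lift_apply_simple (dualReflection_isLiftable M) i

theorem dualRepresentation_simple_of_apply_eq_zero {i : B} {f : B → ℂ} (h : f i = 0) :
    cs.dualRepresentation (cs.simple i) f = f := by
  ext b
  rw [dualRepresentation_simple, dualReflection_apply, h]
  ring

/-- The indicator function `f` of `i` is fixed by `s_j`. If the generators commuted, `s_i f` would
be fixed as well, but its value at `j` is a nonzero number that `s_j` negates. -/
theorem simple_mul_simple_ne_of_adj {i j : B} (h : M.coxeterGraph.Adj i j) :
    cs.simple i * cs.simple j ≠ cs.simple j * cs.simple i := by
  classical
  intro hc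
  have h2 := congrArg (fun x => cs.dualRepresentation x (Pi.single i 1) j) hc
  simp only [map_mul, Module.End.mul_apply] at h2
  rw [dualRepresentation_simple_of_apply_eq_zero cs (i := j) (by simp [h.ne'])] at h2
  simp only [dualRepresentation_simple, dualReflection_apply, cartanCoeff_self, Pi.single_eq_same,
    Pi.single_eq_of_ne h.ne'] at h2
  apply cartanCoeff_ne_zero h
  linear_combination -h2 / 2

end DualRepresentation

/-! ### Commutation and braid relations of two generators -/

theorem simple_mul_simple_comm_of_not_adj {i j : B} (h : ¬ M.coxeterGraph.Adj i j) :
    cs.simple i * cs.simple j = cs.simple j * cs.simple i := by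
  by_cases hij : i = j
  · rw [hij]
  have h1 : M i j ≠ 1 := M.off_diagonal i j hij
  have h2 : M i j = 2 := by
    have : ¬ (M i j = 0 ∨ 3 ≤ M i j) := h
    omega
  have := cs.simple_mul_simple_pow i j
  rw [h2, pow_two, mul_eq_one_iff_eq_inv, mul_inv_rev, inv_simple, inv_simple] at this
  exact this

theorem simple_mul_simple_mul_simple {i j : B} (h : M i j = 3) :
    cs.simple i * cs.simple j * cs.simple i = cs.simple j * cs.simple i * cs.simple j := by
  have := cs.simple_mul_simple_pow i j
  rw [h, pow_succ, pow_two] at this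
  have e : cs.simple i * cs.simple j * cs.simple i *
      (cs.simple j * cs.simple i * cs.simple j) = 1 := by
    rw [← this]; simp only [mul_assoc]
  rw [mul_eq_one_iff_eq_inv] at e
  rw [e]
  simp [mul_assoc]

/-! ### Standard parabolic subgroups -/

section Parabolic

/-- The standard parabolic subgroup generated by a set of simple reflections. -/
def parabolic (I : Set B) : Subgroup W := Subgroup.closure (cs.simple '' I)

theorem simple_mem_parabolic {I : Set B} {i : B} (h : i ∈ I) : cs.simple i ∈ cs.parabolic I :=
  Subgroup.subset_closure ⟨i, h, rfl⟩

/-- For `i ∉ I` the indicator function of `i` is fixed by every generator in `I`, whereas `s_i`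
changes its value at `i` from `1` to `-1`. -/
theorem simple_mem_parabolic_iff {I : Set B} {i : B} :
    cs.simple i ∈ cs.parabolic I ↔ i ∈ I := by
  classical
  refine ⟨fun h => ?_, cs.simple_mem_parabolic⟩
  by_contra hi
  have key : ∀ w ∈ cs.parabolic I,
      cs.dualRepresentation w (Pi.single i 1) = Pi.single i 1 := by
    intro w hw
    induction hw using Subgroup.closure_induction_left with
    | one => simp
    | mul_left x hx y hy ih =>
      obtain ⟨j, hj, rfl⟩ := hx
      rw [map_mul, Module.End.mul_apply, ih]
      exact cs.dualRepresentation_simple_of_apply_eq_zero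
        (Pi.single_eq_of_ne (by rintro rfl; exact hi hj) _)
    | inv_mul_cancel x hx y hy ih =>
      obtain ⟨j, hj, rfl⟩ := hx
      rw [inv_simple, map_mul, Module.End.mul_apply, ih]
      exact cs.dualRepresentation_simple_of_apply_eq_zero
        (Pi.single_eq_of_ne (by rintro rfl; exact hi hj) _)
  have h1 := congrFun (key _ h) i
  rw [dualRepresentation_simple, dualReflection_apply, cartanCoeff_self] at h1
  norm_num at h1

theorem simple_injective : Function.Injective cs.simple := by
  intro i j h
  have := cs.simple_mem_parabolic (Set.mem_singleton i)
  rw [h, simple_mem_parabolic_iff] at this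
  exact this.symm

theorem parabolic_mono {I I' : Set B} (h : I ⊆ I') : cs.parabolic I ≤ cs.parabolic I' :=
  Subgroup.closure_mono (Set.image_mono h)

theorem wordProd_mem_parabolic {I : Set B} {ω : List B} (h : ∀ i ∈ ω, i ∈ I) :
    cs.wordProd ω ∈ cs.parabolic I := by
  induction ω with
  | nil => simp [one_mem]
  | cons i ω ih =>
    rw [wordProd_cons]
    exact mul_mem (cs.simple_mem_parabolic (h i (by simp)))
      (ih fun j hj => h j (List.mem_cons_of_mem _ hj))

/-- Strong exchange, letter by letter, writes an inversion as a conjugate of a generator in `I` by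
an element of the subgroup. -/
theorem mem_parabolic_of_inversion {I : Set B} {w t : W} (hw : w ∈ cs.parabolic I)
    (ht : cs.IsReflection t) (h : cs.length (t * w) < cs.length w) : t ∈ cs.parabolic I := by
  have key : ∀ i ∈ I, ∀ y : W, (∀ t, cs.IsReflection t → cs.length (t * y) < cs.length y →
      t ∈ cs.parabolic I) → ∀ t, cs.IsReflection t →
      cs.length (t * (cs.simple i * y)) < cs.length (cs.simple i * y) → t ∈ cs.parabolic I := by
    intro i hi y ih t ht h
    have hs := cs.simple_mem_parabolic hi
    rcases ht.eq_simple_or_length_lt cs i y h with rfl | h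
    · exact hs
    · have := ih _ (by simpa using ht.conj (cs.simple i)) h
      rwa [Subgroup.mul_mem_cancel_right _ hs, Subgroup.mul_mem_cancel_left _ hs] at this
  induction hw using Subgroup.closure_induction_left generalizing t with
  | one => simp at h
  | mul_left x hx y hy ih =>
    obtain ⟨j, hj, rfl⟩ := hx
    exact key j hj y (fun t ht h => ih ht h) t ht h
  | inv_mul_cancel x hx y hy ih =>
    obtain ⟨j, hj, rfl⟩ := hx
    rw [inv_simple] at h
    exact key j hj y (fun t ht h => ih ht h) t ht h

theorem BruhatLE.mem_parabolic {cs : CoxeterSystem M W} {I : Set B} {u w : W}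
    (h : cs.BruhatLE u w) (hw : w ∈ cs.parabolic I) : u ∈ cs.parabolic I := by
  induction h using Relation.ReflTransGen.head_induction_on with
  | refl => exact hw
  | head h1 h2 ih =>
    obtain ⟨t, ht, rfl, hlt⟩ := bruhatStep_iff_left.1 h1
    have e := ht.mul_self
    have := cs.mem_parabolic_of_inversion ih ht (by rwa [← mul_assoc, e, one_mul])
    rwa [Subgroup.mul_mem_cancel_left _ this] at ih

theorem not_isLeftDescent_of_mem_parabolic {I : Set B} {x : W} {r : B} (hx : x ∈ cs.parabolic I)
    (hr : r ∉ I) : ¬ cs.IsLeftDescent x r := fun h => hr <|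
  cs.simple_mem_parabolic_iff.1 (cs.mem_parabolic_of_inversion hx (cs.isReflection_simple r) h)

/-- The generator `j` is conjugate to `r` by `x`, so it lies in the subgroup of `I ∪ {r}` and hence
in `I ∪ {r}`; if it were in `I`, so would `r` be. -/
theorem eq_of_simple_mul_eq_mul_simple {I : Set B} {x : W} {r j : B} (hx : x ∈ cs.parabolic I)
    (hr : r ∉ I) (h : cs.simple r * x = x * cs.simple j) : j = r := by
  by_contra hjr
  by_cases hj : j ∈ I
  · apply hr
    rw [← cs.simple_mem_parabolic_iff, ← Subgroup.mul_mem_cancel_right _ hx, h]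
    exact mul_mem hx (cs.simple_mem_parabolic hj)
  · have h1 : cs.simple j ∈ cs.parabolic (insert r I) := by
      have hx' := cs.parabolic_mono (Set.subset_insert r I) hx
      rw [← Subgroup.mul_mem_cancel_left _ hx', ← h]
      exact mul_mem (cs.simple_mem_parabolic (Set.mem_insert r I)) hx'
    rw [cs.simple_mem_parabolic_iff] at h1
    exact h1.elim hjr hj

theorem simple_mul_comm_of_mem_parabolic {I : Set B} {x : W} {r : B} (hx : x ∈ cs.parabolic I)
    (h : ∀ i ∈ I, ¬ M.coxeterGraph.Adj r i) : cs.simple r * x = x * cs.simple r := by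
  have : cs.parabolic I ≤ Subgroup.centralizer {cs.simple r} := by
    rw [parabolic, Subgroup.closure_le]
    rintro _ ⟨i, hi, rfl⟩
    rw [SetLike.mem_coe, Subgroup.mem_centralizer_singleton_iff]
    exact (cs.simple_mul_simple_comm_of_not_adj (h i hi)).symm
  exact (Subgroup.mem_centralizer_singleton_iff.1 (this hx)).symm

theorem length_wordProd_of_nodup {ω : List B} (h : ω.Nodup) :
    cs.length (cs.wordProd ω) = ω.length := by
  induction ω with
  | nil => simp
  | cons i ω ih =>
    rw [List.nodup_cons] at h
    have := cs.not_isLeftDescent_of_mem_parabolic (I := {b | b ∈ ω})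
      (cs.wordProd_mem_parabolic fun _ h => h) (by simpa using h.1)
    rw [wordProd_cons, cs.not_isLeftDescent_iff.1 this, ih h.2, List.length_cons]

theorem isLeftDescent_wordProd_cons {s : B} {ω : List B} (h : (s :: ω).Nodup) :
    cs.IsLeftDescent (cs.wordProd (s :: ω)) s := by
  unfold IsLeftDescent
  rw [cs.length_wordProd_of_nodup h, wordProd_cons, simple_mul_simple_cancel_left,
    cs.length_wordProd_of_nodup h.of_cons, List.length_cons]
  omega

/-- If a generator commutes with the product of distinct other generators, then it commutes with
each of them. -/
theorem not_adj_of_simple_mul_wordProd_comm {r : B} {ω : List B} (hω : (r :: ω).Nodup)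
    (h : cs.simple r * cs.wordProd ω = cs.wordProd ω * cs.simple r) :
    ∀ s ∈ ω, ¬ M.coxeterGraph.Adj r s := by
  induction ω with
  | nil => simp
  | cons s ω ih =>
    have hrs : r ≠ s := by rintro rfl; simp at hω
    have hrω : r ∉ ω := by intro h; simp [h] at hω
    have hω' := hω.of_cons
    have hcomm : cs.simple r * cs.simple s = cs.simple s * cs.simple r := by
      -- Write `x` for the product of `ω`. Both `r` and `s` are left descents of `r s x = s x r`, so
      -- `r s r ≤ r s x`. As `r s r` is longer than `s r`, cancelling `r` and then `s` gives `r ≤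
      -- x`, although `r` is not a letter of `x`.
      by_contra hne
      have hx := cs.isLeftDescent_wordProd_cons hω
      have hl := cs.length_wordProd_of_nodup hω
      have hs : cs.IsLeftDescent (cs.wordProd (r :: s :: ω)) s := by
        unfold IsLeftDescent
        rw [hl, wordProd_cons, h, wordProd_cons, mul_assoc, simple_mul_simple_cancel_left]
        have h1 := cs.length_mul_le (cs.wordProd ω) (cs.simple r)
        have h2 := cs.length_wordProd_le ω
        rw [length_simple] at h1
        simp only [List.length_cons]
        omega
      have h1 := (((one_bruhatLE _).simple_mul_le hx).simple_mul_le hs).simple_mul_le hx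
      rw [mul_one] at h1
      have hlsr : cs.length (cs.simple s * cs.simple r) = 2 := by
        have := cs.length_wordProd_of_nodup (ω := [s, r]) (by simp [hrs.symm])
        simpa [wordProd_cons] using this
      have hd : cs.IsLeftDescent (cs.simple r * (cs.simple s * cs.simple r)) r := by
        by_contra hd
        rw [cs.isLeftDescent_iff_not_isLeftDescent_mul, not_not] at hd
        rw [simple_mul_simple_cancel_left] at hd
        rcases (cs.isReflection_simple r).eq_simple_or_length_lt cs s (cs.simple r) hd with e | e
        · exact hrs (cs.simple_injective e)
        · rw [length_simple] at e
          have := cs.length_eq_zero_iff.1 (Nat.lt_one_iff.1 e)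
          rw [mul_assoc, mul_eq_one_iff_eq_inv, mul_inv_rev, inv_simple, inv_simple] at this
          exact hne this.symm
      have h2 := h1.simple_mul_le_simple_mul hd
      rw [wordProd_cons, simple_mul_simple_cancel_left, simple_mul_simple_cancel_left] at h2
      have h3 := h2.simple_mul_le_simple_mul (i := s) (by
        unfold IsLeftDescent; rw [hlsr, simple_mul_simple_cancel_left, length_simple]; omega)
      rw [wordProd_cons, simple_mul_simple_cancel_left, simple_mul_simple_cancel_left] at h3
      have h4 := h3.mem_parabolic (cs.wordProd_mem_parabolic (I := {b | b ∈ ω}) fun _ h => h)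
      exact hrω (cs.simple_mem_parabolic_iff.1 h4)
    intro b hb
    rcases List.mem_cons.1 hb with rfl | hb
    · exact fun hadj => cs.simple_mul_simple_ne_of_adj hadj hcomm
    · refine ih (List.nodup_cons.2 ⟨hrω, hω'.of_cons⟩) ?_ b hb
      rw [wordProd_cons, ← mul_assoc, hcomm, mul_assoc, mul_assoc] at h
      exact mul_left_cancel h

end Parabolic

end CoxeterSystem

namespace CoxeterSystem

variable {B W : Type*} [Group W] {M : CoxeterMatrix B} (cs : CoxeterSystem M W)

/-! ### Minimal coset representatives -/

section MinRep

/-- `w` has no right descent in `J`. -/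
def IsMinRep (J : Set B) (w : W) : Prop := ∀ j ∈ J, ¬ cs.IsRightDescent w j

variable {cs} {J : Set B}

theorem isMinRep_one : cs.IsMinRep J 1 := fun j _ => cs.not_isRightDescent_one j

theorem IsMinRep.simple_mul {w : W} (hw : cs.IsMinRep J w) {s : B} (hs : cs.IsLeftDescent w s) :
    cs.IsMinRep J (cs.simple s * w) := by
  intro j hj h
  apply hw j hj
  have h1 := cs.length_mul_le (cs.simple s) (cs.simple s * w * cs.simple j)
  rw [length_simple, ← mul_assoc, simple_mul_simple_cancel_left] at h1
  have h2 := cs.isLeftDescent_iff.1 hs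
  unfold IsRightDescent at h ⊢
  omega

/-- A right descent `j` of `r x` yields the inversion `(r x) j (r x)⁻¹`. By strong exchange it
equals `r`, which is the claim, or else `j` is already a right descent of `x`. -/
theorem IsMinRep.exists_simple_mul_eq {x : W} (hx : cs.IsMinRep J x) {r : B}
    (h : ¬ cs.IsMinRep J (cs.simple r * x)) :
    ∃ j ∈ J, cs.simple r * x = x * cs.simple j := by
  unfold IsMinRep at h
  push Not at h
  obtain ⟨j, hj, h⟩ := h
  refine ⟨j, hj, ?_⟩
  have ht := (cs.isReflection_simple j).conj (cs.simple r * x)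
  have e : cs.simple r * x * cs.simple j * (cs.simple r * x)⁻¹ * (cs.simple r * x) =
      cs.simple r * x * cs.simple j := by group
  rcases ht.eq_simple_or_length_lt cs r x (by rw [e]; exact h) with h1 | h1
  · rw [h1, simple_mul_simple_cancel_left] at e
    have := congrArg (· * cs.simple j) e
    simpa using this.symm
  · exfalso
    apply hx j hj
    have e2 : cs.simple r * (cs.simple r * x * cs.simple j * (cs.simple r * x)⁻¹) *
        cs.simple r * x = x * cs.simple j := by
      rw [mul_assoc _ (cs.simple r), mul_assoc, e]
      simp [mul_assoc]
    rwa [e2] at h1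

namespace MinRep

/-- The element of `W^J` given by a minimal coset representative. -/
def ofIsMinRep (w : W) (h : cs.IsMinRep J w) : cs.MinRep J := ⟨w, h⟩

theorem ofIsMinRep_val (w : W) (h : cs.IsMinRep J w) : (ofIsMinRep w h).1 = w := rfl

theorem le_iff {u v : cs.MinRep J} : u ≤ v ↔ cs.BruhatLE u.1 v.1 := Iff.rfl

theorem length_le {u v : cs.MinRep J} (h : u ≤ v) : cs.length u.1 ≤ cs.length v.1 :=
  BruhatLE.length_le h

theorem length_lt {u v : cs.MinRep J} (h : u < v) : cs.length u.1 < cs.length v.1 := by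
  rcases BruhatLE.eq_or_length_lt (le_iff.1 h.le) with h1 | h1
  · exact absurd (Subtype.ext h1) h.ne
  · exact h1

theorem covBy_of_length {u v : cs.MinRep J} (h : u ≤ v)
    (hl : cs.length v.1 = cs.length u.1 + 1) : u ⋖ v := by
  refine ⟨lt_of_le_of_ne h (by rintro rfl; omega), fun x hx hx' => ?_⟩
  have h1 := length_lt hx
  have h2 := length_lt hx'
  omega

/-- The product of `w` with one of its left descents. -/
def descend (w : cs.MinRep J) {s : B} (hs : cs.IsLeftDescent w.1 s) : cs.MinRep J :=
  ⟨cs.simple s * w.1, IsMinRep.simple_mul w.2 hs⟩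

theorem descend_covBy (w : cs.MinRep J) {s : B} (hs : cs.IsLeftDescent w.1 s) :
    w.descend hs ⋖ w :=
  covBy_of_length (simple_mul_bruhatLE hs) (cs.isLeftDescent_iff.1 hs).symm

/-- The least element of `W^J`. -/
def bot : cs.MinRep J := ⟨1, isMinRep_one⟩

theorem bot_le (w : cs.MinRep J) : bot ≤ w := one_bruhatLE w.1

theorem val_eq_one_of_isBot {u : cs.MinRep J} (h : IsBot u) : u.1 = 1 :=
  eq_one_of_bruhatLE_one (h bot)

/-- Lengths increase strictly along chains, and removing left descents one at a time gives a chain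
in `W^J` that attains the length. -/
theorem height_eq_length (w : cs.MinRep J) : Order.height w = (cs.length w.1 : ℕ∞) := by
  apply le_antisymm
  · refine Order.height_le fun p hp => ?_
    have key : ∀ i : Fin (p.length + 1), (i : ℕ) ≤ cs.length (p i).1 := by
      intro i
      induction i using Fin.induction with
      | zero => simp
      | succ i ih =>
        have := length_lt (p.step i)
        simp only [Fin.val_succ, Fin.val_castSucc] at ih ⊢
        omega
    have := key (Fin.last _)
    rw [← hp]
    exact_mod_cast this
  · induction hn : cs.length w.1 generalizing w with
    | zero => simp
    | succ n ih =>
      obtain ⟨s, hs⟩ := cs.exists_leftDescent_of_ne_one (w := w.1)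
        (by intro h; rw [h] at hn; simp at hn)
      have h1 := cs.isLeftDescent_iff.1 hs
      have h2 := ih (w.descend hs) (by change cs.length (cs.simple s * w.1) = n; omega)
      have h3 := Order.height_add_one_le (w.descend_covBy hs).lt
      push_cast
      exact (add_le_add_left h2 1).trans h3

end MinRep

end MinRep

/-! ### Simple words -/

section SimpleWord

/-- The words `s_k, …, s_0` in the definition of simple elements. -/
inductive SimpleWord (M : CoxeterMatrix B) (J : Set B) : List B → Prop
  | single {s : B} (hs : s ∉ J) : SimpleWord M J [s]
  | cons {r s : B} {ω : List B} (hr : r ∈ J) (hmem : r ∉ s :: ω) (hadj : M.coxeterGraph.Adj r s)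
      (hω : ∀ b ∈ ω, ¬ M.coxeterGraph.Adj r b) (h : SimpleWord M J (s :: ω)) :
      SimpleWord M J (r :: s :: ω)

variable {cs} {J : Set B}

theorem SimpleWord.nodup {ω : List B} (h : SimpleWord M J ω) : ω.Nodup := by
  induction h with
  | single => simp
  | cons hr hmem hadj hω h ih => exact List.nodup_cons.2 ⟨hmem, ih⟩

theorem SimpleWord.tail {s : B} {ω : List B} (h : SimpleWord M J (s :: ω)) (hne : ω ≠ []) :
    SimpleWord M J ω := by
  cases h with
  | single => exact absurd rfl hne
  | cons _ _ _ _ h => exact h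

theorem SimpleWord.eq_nil {s : B} {ω : List B} (h : SimpleWord M J (s :: ω)) (hs : s ∉ J) :
    ω = [] := by
  cases h with
  | single => rfl
  | cons hr => exact absurd hr hs

/-- Otherwise the leftmost letter would commute with all letters after it, including its neighbour.
-/
theorem SimpleWord.isMinRep (cs : CoxeterSystem M W) {ω : List B} (h : SimpleWord M J ω) :
    cs.IsMinRep J (cs.wordProd ω) := by
  induction h with
  | single hs =>
    by_contra hn
    rw [wordProd_cons] at hn
    obtain ⟨j, hj, e⟩ := IsMinRep.exists_simple_mul_eq (J := J) isMinRep_one hn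
    simp only [mul_one, one_mul] at e
    exact hs (cs.simple_injective e ▸ hj)
  | @cons r s ω hr hmem hadj hω h ih =>
    by_contra hn
    rw [wordProd_cons] at hn
    have hx := cs.wordProd_mem_parabolic (I := {b | b ∈ s :: ω}) fun _ h => h
    obtain ⟨j, hj, e⟩ := ih.exists_simple_mul_eq hn
    obtain rfl := cs.eq_of_simple_mul_eq_mul_simple hx hmem e
    exact cs.not_adj_of_simple_mul_wordProd_comm (List.nodup_cons.2 ⟨hmem, h.nodup⟩) e s
      (by simp) hadj

/-- The element of `W^J` given by a simple word. -/
def SimpleWord.toMinRep (cs : CoxeterSystem M W) {ω : List B} (h : SimpleWord M J ω) :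
    cs.MinRep J := ⟨cs.wordProd ω, h.isMinRep cs⟩

theorem SimpleWord.tail_isMinRep (cs : CoxeterSystem M W) {s : B} {ω : List B}
    (h : SimpleWord M J (s :: ω)) : cs.IsMinRep J (cs.wordProd ω) := by
  have := (h.isMinRep cs).simple_mul (cs.isLeftDescent_wordProd_cons h.nodup)
  rwa [wordProd_cons, simple_mul_simple_cancel_left] at this

theorem SimpleWord.bruhatLE_tail {s : B} {ω : List B} (h : SimpleWord M J (s :: ω)) {v : W}
    (hv : cs.IsMinRep J v) (hle : cs.BruhatLE v (cs.wordProd (s :: ω)))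
    (hne : v ≠ cs.wordProd (s :: ω)) : cs.BruhatLE v (cs.wordProd ω) := by
  induction ω generalizing s v with
  | nil =>
    by_cases hd : cs.IsLeftDescent v s
    · have h1 := hle.simple_mul_le_simple_mul hd
      rw [wordProd_cons, simple_mul_simple_cancel_left, wordProd_nil] at h1
      have h2 := eq_one_of_bruhatLE_one h1
      refine absurd ?_ hne
      rw [wordProd_cons, wordProd_nil, ← h2, simple_mul_simple_cancel_left]
    · simpa [wordProd_cons] using hle.le_simple_mul hd
  | cons r ω ih =>
    by_cases hd : cs.IsLeftDescent v s
    · exfalso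
      have h1 := hle.simple_mul_le_simple_mul hd
      rw [wordProd_cons, simple_mul_simple_cancel_left] at h1
      have h2 := ih (h.tail (by simp)) (hv.simple_mul hd) h1 (by
        intro e
        apply hne
        rw [wordProd_cons, ← e, simple_mul_simple_cancel_left])
      have h3 := h2.mem_parabolic (cs.wordProd_mem_parabolic (I := {b | b ∈ ω}) fun _ h => h)
      cases h with
      | cons hs hmem hadj hω h =>
        have h4 := cs.simple_mul_comm_of_mem_parabolic h3 hω
        rw [simple_mul_simple_cancel_left] at h4
        apply hv s hs
        unfold IsRightDescent
        nth_rw 1 [h4]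
        rw [simple_mul_simple_cancel_right]
        exact hd
    · simpa [wordProd_cons _ s] using hle.le_simple_mul hd

/-- The lower neighbour of the element of a simple word. -/
theorem SimpleWord.covBy_iff {s : B} {ω : List B} (h : SimpleWord M J (s :: ω))
    {w : cs.MinRep J} (hw : w.1 = cs.wordProd (s :: ω)) (v : cs.MinRep J) :
    v ⋖ w ↔ v.1 = cs.wordProd ω := by
  have hd := cs.isLeftDescent_wordProd_cons h.nodup
  rw [← hw] at hd
  have he : (w.descend hd).1 = cs.wordProd ω := by
    change cs.simple s * w.1 = _
    rw [hw, wordProd_cons, simple_mul_simple_cancel_left]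
  have hcov := w.descend_covBy hd
  constructor
  · intro hv
    have h1 : v ≤ w.descend hd := by
      rw [MinRep.le_iff, he]
      exact h.bruhatLE_tail v.2 (hw ▸ hv.le) fun e => hv.ne (Subtype.ext (e.trans hw.symm))
    rw [← he, eq_of_le_of_not_lt h1 fun hlt => hv.2 hlt hcov.lt]
  · intro hv
    rwa [show v = w.descend hd from Subtype.ext (hv.trans he.symm)]

theorem SimpleWord.isChainlike {ω : List B} (h : SimpleWord M J ω)
    {w : cs.MinRep J} (hw : w.1 = cs.wordProd ω) : IsChainlike w := by
  induction h generalizing w with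
  | @single s hs =>
    have h := SimpleWord.single (M := M) hs
    have hb : (MinRep.bot : cs.MinRep J).1 = cs.wordProd [] := (cs.wordProd_nil).symm
    exact .base ((h.covBy_iff hw _).2 hb)
      (fun v hv => Subtype.ext (((h.covBy_iff hw v).1 hv).trans hb.symm)) MinRep.bot_le
  | @cons r s ω hr hmem hadj hω h ih =>
    have h' := SimpleWord.cons hr hmem hadj hω h
    exact .step ((h'.covBy_iff hw (h.toMinRep cs)).2 rfl)
      (fun v hv => Subtype.ext ((h'.covBy_iff hw v).1 hv)) (ih rfl)

theorem simpleWord_ofFn_reverse {k : ℕ} {s : Fin (k + 1) → B} (hinj : Function.Injective s)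
    (h0 : s 0 ∉ J) (hJ : ∀ i, i ≠ 0 → s i ∈ J)
    (hadj : ∀ i j, M.coxeterGraph.Adj (s i) (s j) ↔ ((i : ℕ) + 1 = j ∨ (j : ℕ) + 1 = i)) :
    SimpleWord M J (List.ofFn s).reverse := by
  induction k with
  | zero => simpa using SimpleWord.single h0
  | succ k ih =>
    have h1 := ih (s := fun i => s i.castSucc) (hinj.comp (Fin.castSucc_injective _)) h0
      (fun i hi => hJ _ fun h => hi (Fin.castSucc_injective _ h)) (fun i j => hadj _ _)
    rw [List.ofFn_succ', List.concat_eq_append, List.reverse_append, List.reverse_singleton,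
      List.singleton_append]
    rw [List.ofFn_succ', List.concat_eq_append, List.reverse_append, List.reverse_singleton,
      List.singleton_append] at h1 ⊢
    refine .cons (hJ _ (Fin.last_pos).ne') ?_ ?_ ?_ h1
    · simp only [List.mem_cons, List.mem_reverse, List.mem_ofFn, not_or, not_exists]
      refine ⟨fun h => ?_, fun i h => ?_⟩
      · have := hinj h
        simp [Fin.ext_iff] at this
      · have := hinj h
        simp only [Fin.ext_iff, Fin.val_castSucc, Fin.val_last] at this
        omega
    · rw [hadj]; right; simp
    · intro b hb
      simp only [List.mem_reverse, List.mem_ofFn] at hb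
      obtain ⟨i, rfl⟩ := hb
      rw [hadj]
      simp only [Fin.val_castSucc, Fin.val_last]
      omega

theorem SimpleWord.exists_ofFn_reverse {ω : List B} (h : SimpleWord M J ω) :
    ∃ (k : ℕ) (s : Fin (k + 1) → B), Function.Injective s ∧ s 0 ∉ J ∧ (∀ i, i ≠ 0 → s i ∈ J) ∧
      (∀ i j, M.coxeterGraph.Adj (s i) (s j) ↔ ((i : ℕ) + 1 = j ∨ (j : ℕ) + 1 = i)) ∧
      ω = (List.ofFn s).reverse := by
  induction h with
  | @single s hs =>
    exact ⟨0, fun _ => s, fun i j _ => by omega, hs, fun i hi => by omega,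
      fun i j => by simp, by simp⟩
  | @cons r t ω hr hmem hadj hω h ih =>
    obtain ⟨k, s, hinj, h0, hJ, hs, e⟩ := ih
    have e' := e
    rw [List.ofFn_succ', List.concat_eq_append, List.reverse_append, List.reverse_singleton,
      List.singleton_append, List.cons.injEq] at e'
    have hlast : ∀ i : Fin (k + 1), M.coxeterGraph.Adj r (s i) ↔ (i : ℕ) = k := by
      intro i
      refine i.lastCases ?_ fun i => ?_
      · rw [← e'.1]; simpa using hadj
      · have := hω (s i.castSucc) (by rw [e'.2]; simp)
        simp only [Fin.val_castSucc]
        exact ⟨fun h => absurd h this, fun h => by omega⟩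
    have hr' : ∀ i, s i ≠ r := by
      rintro i rfl
      apply hmem
      rw [e, List.mem_reverse, List.mem_ofFn]
      exact ⟨i, rfl⟩
    refine ⟨k + 1, Fin.snoc s r, ?_, ?_, ?_, ?_, ?_⟩
    · rw [Fin.snoc_injective_iff]
      exact ⟨hinj, by rintro ⟨i, hi⟩; exact hr' i hi⟩
    · have : (0 : Fin (k + 2)) = Fin.castSucc 0 := rfl
      rw [this, Fin.snoc_castSucc]
      exact h0
    · intro i
      refine i.lastCases (fun _ => by rwa [Fin.snoc_last]) fun i hi => ?_
      rw [Fin.snoc_castSucc]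
      exact hJ i (by rintro rfl; exact hi rfl)
    · intro i j
      refine i.lastCases ?_ fun i => ?_ <;> refine j.lastCases ?_ fun j => ?_
      · simp
      · rw [Fin.snoc_last, Fin.snoc_castSucc, hlast]
        simp only [Fin.val_last, Fin.val_castSucc]
        omega
      · rw [Fin.snoc_last, Fin.snoc_castSucc, SimpleGraph.adj_comm, hlast]
        simp only [Fin.val_last, Fin.val_castSucc]
        omega
      · rw [Fin.snoc_castSucc, Fin.snoc_castSucc, hs]
        simp
    · rw [List.ofFn_succ', List.concat_eq_append, List.reverse_append, List.reverse_singleton,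
        List.singleton_append, Fin.snoc_last]
      simp only [Fin.snoc_castSucc]
      rw [e]

theorem MinRep.isSimple_iff {w : cs.MinRep J} :
    w.IsSimple ↔ ∃ ω, SimpleWord M J ω ∧ w.1 = cs.wordProd ω := by
  constructor
  · rintro ⟨k, s, hinj, h0, hJ, hadj, hw⟩
    exact ⟨_, simpleWord_ofFn_reverse hinj h0 hJ hadj, hw⟩
  · rintro ⟨ω, hω, hw⟩
    obtain ⟨k, s, hinj, h0, hJ, hs, e⟩ := hω.exists_ofFn_reverse
    exact ⟨k, s, hinj, h0, hJ, hs, e ▸ hw⟩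

theorem MinRep.IsSimple.isChainlike {w : cs.MinRep J} (h : w.IsSimple) : IsChainlike w := by
  obtain ⟨ω, hω, hw⟩ := isSimple_iff.1 h
  exact hω.isChainlike hw

end SimpleWord

end CoxeterSystem

namespace CoxeterSystem

variable {B W : Type*} [Group W] {M : CoxeterMatrix B} {cs : CoxeterSystem M W} {J : Set B}

/-! ### Chainlike elements in the simply-laced case -/

section SimplyLaced

namespace MinRep

/-- An element covering exactly one element has exactly one left descent. -/
theorem eq_simple_mul_of_unique {w u : cs.MinRep J} (hcov : u ⋖ w)
    (huniq : ∀ v, v ⋖ w → v = u) :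
    ∃ r, w.1 = cs.simple r * u.1 ∧ ∀ q, cs.IsLeftDescent w.1 q ↔ q = r := by
  obtain ⟨r, hr⟩ := cs.exists_leftDescent_of_ne_one (w := w.1) (by
    intro h
    have := length_lt hcov.lt
    rw [h, length_one] at this
    omega)
  have key : ∀ q, (hq : cs.IsLeftDescent w.1 q) → cs.simple q * w.1 = u.1 :=
    fun q hq => congrArg Subtype.val (huniq _ (w.descend_covBy hq))
  refine ⟨r, by rw [← key r hr, simple_mul_simple_cancel_left], fun q => ⟨fun hq => ?_, ?_⟩⟩
  · exact cs.simple_injective (mul_right_cancel ((key q hq).trans (key r hr).symm))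
  · rintro rfl
    exact hr

theorem _root_.IsChainlike.isSimple (hM : M.SimplyLaced) {w : cs.MinRep J} (h : IsChainlike w) :
    ∃ ω, SimpleWord M J ω ∧ w.1 = cs.wordProd ω := by
  induction h with
  | @base u w hcov huniq hbot =>
    obtain ⟨r, hw, hr⟩ := eq_simple_mul_of_unique hcov huniq
    rw [val_eq_one_of_isBot hbot, mul_one] at hw
    refine ⟨[r], .single fun hrJ => w.2 r hrJ ?_, by simpa [wordProd_cons] using hw⟩
    rw [hw, IsRightDescent]
    simp
  | @step u w hcov huniq hu ih =>
    obtain ⟨r, hw, hr⟩ := eq_simple_mul_of_unique hcov huniq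
    obtain ⟨ω₀, hω₀, hu⟩ := ih
    obtain ⟨s, ω, rfl⟩ : ∃ s ω, ω₀ = s :: ω := by
      cases hω₀ <;> exact ⟨_, _, rfl⟩
    have hlu := cs.length_wordProd_of_nodup hω₀.nodup
    have hlw : cs.length w.1 = ω.length + 2 := by
      have := cs.isLeftDescent_iff.1 ((hr r).2 rfl)
      rw [hw, simple_mul_simple_cancel_left, hu, hlu, ← hu, ← hw] at this
      exact this.symm
    rw [hu, wordProd_cons] at hw
    have hrs : r ≠ s := by
      rintro rfl
      rw [simple_mul_simple_cancel_left] at hw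
      have := cs.length_wordProd_le ω
      rw [← hw] at this
      omega
    -- The unique left descent is `r ≠ s`, so `s w` cannot be this short; this excludes commutation
    -- of `r` and `s` as well as a braid move.
    have hns : ¬ cs.length (cs.simple s * w.1) ≤ ω.length + 1 := by
      intro h
      exact hrs ((hr s).1 (by unfold IsLeftDescent; omega)).symm
    have hadj : M.coxeterGraph.Adj r s := by
      by_contra hn
      apply hns
      rw [hw, ← mul_assoc, ← mul_assoc, mul_assoc (cs.simple s),
        cs.simple_mul_simple_comm_of_not_adj hn, simple_mul_simple_cancel_left, ← wordProd_cons]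
      exact cs.length_wordProd_le (r :: ω)
    have hrω : r ∉ ω := by
      intro hmem
      cases hω₀ with
      | single => simp at hmem
      | @cons _ q ω' hs' hmem' hadj' hω' h' =>
        rcases List.mem_cons.1 hmem with rfl | hmem
        -- With `r` also the letter after `s`, the braid relation turns `s w` into `r s ω'`, which
        -- is too short.
        · have h3 : M r s = 3 := by
            rcases hM r s hrs with h2 | h3
            · rcases hadj with h | h <;> omega
            · exact h3
          apply hns
          have e := cs.simple_mul_simple_mul_simple h3
          have : cs.simple s * w.1 = cs.wordProd (r :: s :: ω') := by
            rw [hw, wordProd_cons, wordProd_cons, wordProd_cons]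
            have := congrArg (fun x => cs.simple s * (x * cs.wordProd ω')) e
            simpa [mul_assoc] using this
          rw [this]
          exact cs.length_wordProd_le _
        · exact hω' r hmem hadj.symm
    have hmin := hω₀.tail_isMinRep cs
    have hndr : (r :: ω).Nodup := List.nodup_cons.2 ⟨hrω, hω₀.nodup.of_cons⟩
    -- Otherwise `r x`, with `x` the product of `ω`, would be covered by `w` besides `s x`.
    have hny : ¬ cs.IsMinRep J (cs.simple r * cs.wordProd ω) := by
      intro hy
      have hcov' : ofIsMinRep _ hy ⋖ w := by
        apply covBy_of_length
        · rw [le_iff, hw, ofIsMinRep_val]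
          have h1 : cs.BruhatLE (cs.wordProd ω) (cs.simple s * cs.wordProd ω) := by
            have := simple_mul_bruhatLE (cs.isLeftDescent_wordProd_cons hω₀.nodup)
            rwa [wordProd_cons, simple_mul_simple_cancel_left] at this
          refine h1.simple_mul_le_simple_mul' fun hd => ?_
          unfold IsLeftDescent at hd
          rw [← hw, hlw, ← wordProd_cons, hlu, List.length_cons] at hd
          omega
        · rw [hlw, ofIsMinRep_val, ← wordProd_cons, cs.length_wordProd_of_nodup hndr]
          rfl
      have := congrArg Subtype.val (huniq _ hcov')
      rw [hu, ofIsMinRep_val, wordProd_cons] at this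
      exact hrs (cs.simple_injective (mul_right_cancel this))
    obtain ⟨j, hj, e⟩ := hmin.exists_simple_mul_eq hny
    obtain rfl := cs.eq_of_simple_mul_eq_mul_simple
      (cs.wordProd_mem_parabolic (I := {b | b ∈ ω}) fun _ h => h) hrω e
    exact ⟨_, .cons hj (by simp [hrs, hrω]) hadj (cs.not_adj_of_simple_mul_wordProd_comm hndr e)
      hω₀, by rw [hw, wordProd_cons, wordProd_cons]⟩

theorem isSimple_iff_isChainlike (hM : M.SimplyLaced) (w : cs.MinRep J) :
    w.IsSimple ↔ IsChainlike w :=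
  ⟨IsSimple.isChainlike, fun h => isSimple_iff.2 (h.isSimple hM)⟩

end MinRep

end SimplyLaced

/-! ### Common upper bounds -/

section UpperBounds

namespace MinRep

/-- Going up from `w` by a generator `r`, within `W^J`. -/
theorem exists_ge_simple_mul (w : cs.MinRep J) (r : B) :
    ∃ w₂ : cs.MinRep J, w ≤ w₂ ∧ cs.length w₂.1 ≤ cs.length w.1 + 1 ∧
      ∀ x y : cs.MinRep J, x ≤ w → y.1 = cs.simple r * x.1 → y ≤ w₂ := by
  by_cases hd : cs.IsLeftDescent w.1 r
  · refine ⟨w, le_rfl, Nat.le_succ _, fun x y hx hy => ?_⟩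
    rw [le_iff, hy]
    exact BruhatLE.simple_mul_le hx hd
  have hl := cs.not_isLeftDescent_iff.1 hd
  by_cases hm : cs.IsMinRep J (cs.simple r * w.1)
  · refine ⟨ofIsMinRep _ hm, bruhatLE_simple_mul (by omega), hl.le, fun x y hx hy => ?_⟩
    rw [le_iff, hy]
    exact BruhatLE.simple_mul_le_simple_mul' hx hd
  -- Now `r w = w j`, and `y ≤ w j` implies `y ≤ w` because `y` has no right descent in `J`.
  · obtain ⟨j, hj, e⟩ := IsMinRep.exists_simple_mul_eq w.2 hm
    refine ⟨w, le_rfl, Nat.le_succ _, fun x y hx hy => ?_⟩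
    have h1 : cs.BruhatLE y.1 (w.1 * cs.simple j) := by
      rw [hy, ← e]
      exact BruhatLE.simple_mul_le_simple_mul' hx hd
    have h2 := h1.le_mul_simple (y.2 j hj)
    rwa [simple_mul_simple_cancel_right] at h2

theorem exists_ge_ge (u v : cs.MinRep J) : ∃ w : cs.MinRep J, u ≤ w ∧ v ≤ w := by
  induction hn : cs.length u.1 generalizing u with
  | zero =>
    have : u = bot := Subtype.ext (cs.length_eq_zero_iff.1 hn)
    exact ⟨v, this ▸ bot_le v, le_rfl⟩
  | succ n ih =>
    obtain ⟨s, hs⟩ := cs.exists_leftDescent_of_ne_one (w := u.1)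
      (by intro h; rw [h] at hn; simp at hn)
    have h1 := cs.isLeftDescent_iff.1 hs
    obtain ⟨w, hw, hw'⟩ := ih (u.descend hs) (by change cs.length (cs.simple s * u.1) = n; omega)
    obtain ⟨w₂, h2, -, h3⟩ := exists_ge_simple_mul w s
    exact ⟨w₂, h3 _ u hw (cs.simple_mul_simple_cancel_left s).symm, hw'.trans h2⟩

theorem minUpperLength_le {u v w : cs.MinRep J} (hu : u ≤ w) (hv : v ≤ w) :
    minUpperLength u v ≤ cs.length w.1 := by
  rw [← height_eq_length]
  exact iInf_le_of_le w (iInf_le_of_le hu (iInf_le _ hv))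

theorem exists_minUpperLength (u v : cs.MinRep J) :
    ∃ w : cs.MinRep J, u ≤ w ∧ v ≤ w ∧ minUpperLength u v = cs.length w.1 := by
  obtain ⟨w, ⟨hu, hv⟩, hmin⟩ := exists_minimalFor_of_wellFoundedLT
    (fun w : cs.MinRep J => u ≤ w ∧ v ≤ w) (fun w => cs.length w.1) (exists_ge_ge u v)
  refine ⟨w, hu, hv, le_antisymm (minUpperLength_le hu hv) ?_⟩
  refine le_iInf fun x => le_iInf fun hx => le_iInf fun hx' => ?_
  rw [height_eq_length, Nat.cast_le]
  exact (le_total _ _).elim id (hmin ⟨hx, hx'⟩)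

theorem minUpperLength_comm (u v : cs.MinRep J) : minUpperLength u v = minUpperLength v u := by
  unfold minUpperLength
  congr 1
  funext w
  exact iInf_comm

/-- If `s` does not occur in `x` and is the only left descent of `v`, then replacing `v` by `s v`
lowers the lengths of common upper bounds with `x`. -/
theorem exists_upper_of_left_descent {I : Set B} {s : B} (hs : s ∉ I) {v v' : cs.MinRep J}
    (hv : v.1 = cs.simple s * v'.1) (hd : ∀ q, cs.IsLeftDescent v.1 q ↔ q = s)
    {x w : cs.MinRep J} (hx : x.1 ∈ cs.parabolic I) (hxw : x ≤ w) (hvw : v ≤ w) :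
    ∃ w₂ : cs.MinRep J, x ≤ w₂ ∧ v' ≤ w₂ ∧ cs.length w₂.1 + 1 ≤ cs.length w.1 := by
  have hsv : cs.simple s * v.1 = v'.1 := by rw [hv, simple_mul_simple_cancel_left]
  induction hn : cs.length w.1 generalizing w x with
  | zero =>
    have h1 := length_le hvw
    have h2 : cs.length (cs.simple s * v.1) < cs.length v.1 := (hd s).2 rfl
    omega
  | succ n ih =>
    obtain ⟨r, hr⟩ := cs.exists_leftDescent_of_ne_one (w := w.1)
      (by intro h; rw [h] at hn; simp at hn)
    have hl := cs.isLeftDescent_iff.1 hr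
    by_cases hrs : r = s
    -- Here `s w` itself works: it stays above `x`, in which `s` does not occur.
    · subst hrs
      refine ⟨w.descend hr, BruhatLE.le_simple_mul hxw
        (cs.not_isLeftDescent_of_mem_parabolic hx hs), ?_, ?_⟩
      · rw [le_iff, ← hsv]
        exact BruhatLE.simple_mul_le_simple_mul hvw ((hd r).2 rfl)
      · change cs.length (cs.simple r * w.1) + 1 ≤ _
        omega
    -- Since `r` is not a left descent of `v`, induction applies below `r w`. If `r` had to be
    -- removed from `x`, it is restored at a cost of at most one in length.
    · have hvw' : v ≤ w.descend hr := BruhatLE.le_simple_mul hvw (by rwa [hd])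
      have hln : cs.length (w.descend hr).1 = n := by
        change cs.length (cs.simple r * w.1) = n
        omega
      by_cases hxr : cs.IsLeftDescent x.1 r
      · have hx' : (x.descend hxr).1 ∈ cs.parabolic I :=
          mul_mem (cs.mem_parabolic_of_inversion hx (cs.isReflection_simple r) hxr) hx
        obtain ⟨w₃, h1, h2, h3⟩ :=
          ih hx' (BruhatLE.simple_mul_le_simple_mul hxw hxr) hvw' hln
        obtain ⟨w₂, h4, h5, h6⟩ := exists_ge_simple_mul w₃ r
        exact ⟨w₂, h6 _ x h1 (cs.simple_mul_simple_cancel_left r).symm, h2.trans h4, by omega⟩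
      · obtain ⟨w₃, h1, h2, h3⟩ := ih hx (BruhatLE.le_simple_mul hxw hxr) hvw' hln
        exact ⟨w₃, h1, h2, by omega⟩

/-- A bound for `u'` and `v` can be traded for a shorter one for `u'` and `v'`; going up by `s`
bounds `u` and `v` without exceeding the original length. -/
theorem minUpperLength_eq_of_left_descent {I : Set B} {s : B} (hs : s ∉ I) {u u' v v' : cs.MinRep J}
    (hu : u.1 = cs.simple s * u'.1) (hu'u : u' ≤ u) (hu' : u'.1 ∈ cs.parabolic I)
    (hv : v.1 = cs.simple s * v'.1) (hd : ∀ q, cs.IsLeftDescent v.1 q ↔ q = s) :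
    minUpperLength u v = minUpperLength u' v := by
  apply le_antisymm
  · obtain ⟨w, h1, h2, h3⟩ := exists_minUpperLength u' v
    obtain ⟨w₂, h4, h5, h6⟩ := exists_upper_of_left_descent hs hv hd hu' h1 h2
    obtain ⟨w₃, h7, h8, h9⟩ := exists_ge_simple_mul w₂ s
    rw [h3]
    refine (minUpperLength_le (h9 _ u h4 hu) (h9 _ v h5 hv)).trans ?_
    exact_mod_cast h8.trans h6
  · obtain ⟨w, h1, h2, h3⟩ := exists_minUpperLength u v
    rw [h3]
    exact minUpperLength_le (hu'u.trans h1) h2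

/-- Take a left descent `r` of a shortest common upper bound `w`. If `s ≠ t`, then `r w` still
bounds one of the pairs `u', v` (for `r = s`), `u, v'` (for `r = t`) or `u, v`, all with the same
`L`. -/
theorem eq_of_minUpperLength_eq {s t : B} {u u' v v' : cs.MinRep J}
    (hu : u.1 = cs.simple s * u'.1) (hdu : ∀ q, cs.IsLeftDescent u.1 q ↔ q = s)
    (hv : v.1 = cs.simple t * v'.1) (hdv : ∀ q, cs.IsLeftDescent v.1 q ↔ q = t)
    (h₁ : minUpperLength u v = minUpperLength u' v)
    (h₂ : minUpperLength u v = minUpperLength u v') : s = t := by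
  by_contra hst
  obtain ⟨w, h1, h2, h3⟩ := exists_minUpperLength u v
  obtain ⟨r, hr⟩ := cs.exists_leftDescent_of_ne_one (w := w.1) (by
    intro h
    have h4 := length_le h1
    rw [h, length_one] at h4
    have h5 : cs.length (cs.simple s * u.1) < cs.length u.1 := (hdu s).2 rfl
    omega)
  have key : ¬ minUpperLength u v ≤ cs.length (w.descend hr).1 := by
    rw [h3, Nat.cast_le, not_le]
    exact hr
  by_cases hrs : r = s
  · subst hrs
    apply key
    rw [h₁]
    refine minUpperLength_le ?_ (BruhatLE.le_simple_mul h2 (by rwa [hdv]))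
    have := BruhatLE.simple_mul_le_simple_mul h1 ((hdu r).2 rfl)
    rwa [hu, simple_mul_simple_cancel_left] at this
  by_cases hrt : r = t
  · subst hrt
    apply key
    rw [h₂]
    refine minUpperLength_le (BruhatLE.le_simple_mul h1 (by rwa [hdu])) ?_
    have := BruhatLE.simple_mul_le_simple_mul h2 ((hdv r).2 rfl)
    rwa [hv, simple_mul_simple_cancel_left] at this
  · exact key (minUpperLength_le (BruhatLE.le_simple_mul h1 (by rwa [hdu]))
      (BruhatLE.le_simple_mul h2 (by rwa [hdv])))

end MinRep

end UpperBounds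

end CoxeterSystem

namespace CoxeterSystem

variable {B W : Type*} [Group W] {M : CoxeterMatrix B} {cs : CoxeterSystem M W} {J : Set B}

/-! ### The relation `∼` and leftmost generators -/

section Head

namespace MinRep

theorem isLeftDescent_iff_eq_head {s : B} {ω : List B} (h : SimpleWord M J (s :: ω))
    {w : cs.MinRep J} (hw : w.1 = cs.wordProd (s :: ω)) (q : B) :
    cs.IsLeftDescent w.1 q ↔ q = s := by
  have key : ∀ q, cs.IsLeftDescent w.1 q → cs.simple q * w.1 = cs.wordProd ω :=
    fun q hq => (h.covBy_iff hw _).1 (w.descend_covBy hq)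
  have hs : cs.IsLeftDescent w.1 s := hw ▸ cs.isLeftDescent_wordProd_cons h.nodup
  refine ⟨fun hq => cs.simple_injective (mul_right_cancel ((key q hq).trans (key s hs).symm)), ?_⟩
  rintro rfl
  exact hs

theorem exists_simpleWord_cons (hM : M.SimplyLaced) (u : Chainlikes (cs.MinRep J)) :
    ∃ s ω, SimpleWord M J (s :: ω) ∧ u.1.1 = cs.wordProd (s :: ω) := by
  obtain ⟨ω, hω, hu⟩ := u.2.isSimple hM
  cases hω with
  | single hs => exact ⟨_, _, .single hs, hu⟩
  | cons hr hmem hadj hω h => exact ⟨_, _, .cons hr hmem hadj hω h, hu⟩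

/-- The leftmost generator of a chainlike element. -/
noncomputable def head (hM : M.SimplyLaced) (u : Chainlikes (cs.MinRep J)) : B :=
  (exists_simpleWord_cons hM u).choose

theorem exists_simpleWord_head (hM : M.SimplyLaced) (u : Chainlikes (cs.MinRep J)) :
    ∃ ω, SimpleWord M J (head hM u :: ω) ∧ u.1.1 = cs.wordProd (head hM u :: ω) :=
  (exists_simpleWord_cons hM u).choose_spec

theorem head_eq (hM : M.SimplyLaced) {u : Chainlikes (cs.MinRep J)} {s : B} {ω : List B}
    (h : SimpleWord M J (s :: ω)) (hu : u.1.1 = cs.wordProd (s :: ω)) : head hM u = s := by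
  obtain ⟨ω', h', hu'⟩ := exists_simpleWord_head hM u
  exact (isLeftDescent_iff_eq_head h hu _).1 ((isLeftDescent_iff_eq_head h' hu' _).2 rfl)

/-- The chainlike element of a simple word. -/
def ofSimpleWord (cs : CoxeterSystem M W) {ω : List B} (h : SimpleWord M J ω) :
    Chainlikes (cs.MinRep J) :=
  ⟨h.toMinRep cs, h.isChainlike rfl⟩

theorem head_ofSimpleWord (hM : M.SimplyLaced) {s : B} {ω : List B}
    (h : SimpleWord M J (s :: ω)) : head hM (ofSimpleWord cs h) = s :=
  head_eq hM h rfl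

theorem chainSim_iff (hM : M.SimplyLaced) (u v : Chainlikes (cs.MinRep J)) :
    ChainSim u v ↔ head hM u = head hM v := by
  obtain ⟨ω, hω, hu⟩ := exists_simpleWord_head hM u
  obtain ⟨ω', hω', hv⟩ := exists_simpleWord_head hM v
  have hdu := isLeftDescent_iff_eq_head hω hu
  have hdv := isLeftDescent_iff_eq_head hω' hv
  have hu' := hω.covBy_iff hu
  have hv' := hω'.covBy_iff hv
  constructor
  · rintro ⟨u', v', h1, h2, h3, h4⟩
    exact eq_of_minUpperLength_eq (u' := u') (v' := v')
      (by rw [(hu' u').1 h1, ← wordProd_cons, hu]) hdu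
      (by rw [(hv' v').1 h2, ← wordProd_cons, hv]) hdv h3 (h3.trans h4)
  · intro h
    have hcu : ofIsMinRep _ (hω.tail_isMinRep cs) ⋖ u.1 := (hu' _).2 rfl
    have hcv : ofIsMinRep _ (hω'.tail_isMinRep cs) ⋖ v.1 := (hv' _).2 rfl
    have eu : u.1.1 = cs.simple (head hM u) * (ofIsMinRep _ (hω.tail_isMinRep cs)).1 := by
      rw [ofIsMinRep_val, ← wordProd_cons, hu]
    have ev : v.1.1 = cs.simple (head hM v) * (ofIsMinRep _ (hω'.tail_isMinRep cs)).1 := by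
      rw [ofIsMinRep_val, ← wordProd_cons, hv]
    have h1 := minUpperLength_eq_of_left_descent (I := {b | b ∈ ω}) (s := head hM u)
      (List.nodup_cons.1 hω.nodup).1 eu hcu.le
      (cs.wordProd_mem_parabolic fun _ h => h) (by rw [h]; exact ev) (by rw [h]; exact hdv)
    have h2 := minUpperLength_eq_of_left_descent (I := {b | b ∈ ω'}) (s := head hM v)
      (List.nodup_cons.1 hω'.nodup).1 ev hcv.le
      (cs.wordProd_mem_parabolic fun _ h => h) (by rw [← h]; exact eu) (by rw [← h]; exact hdu)
    rw [minUpperLength_comm, minUpperLength_comm _ u.1] at h2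
    exact ⟨_, _, hcu, hcv, h1, h1.symm.trans h2⟩

theorem chainSim_equivalence (hM : M.SimplyLaced) :
    Equivalence (ChainSim (P := cs.MinRep J)) where
  refl u := (chainSim_iff hM u u).2 rfl
  symm h := (chainSim_iff hM _ _).2 ((chainSim_iff hM _ _).1 h).symm
  trans h h' := (chainSim_iff hM _ _).2
    (((chainSim_iff hM _ _).1 h).trans ((chainSim_iff hM _ _).1 h'))

/-- The leftmost generator of a class. -/
noncomputable def nodeHead (hM : M.SimplyLaced) : ChainNode (cs.MinRep J) → B :=
  Quot.lift (head hM) fun u v => (chainSim_iff hM u v).1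

theorem nodeHead_mk (hM : M.SimplyLaced) (u : Chainlikes (cs.MinRep J)) :
    nodeHead hM (Quot.mk _ u) = head hM u := rfl

theorem nodeHead_injective (hM : M.SimplyLaced) :
    Function.Injective (nodeHead (cs := cs) (J := J) hM) := by
  rintro ⟨u⟩ ⟨v⟩ h
  exact Quot.sound ((chainSim_iff hM u v).2 h)

end MinRep

end Head

/-! ### Existence of simple words -/

section Existence

theorem SimpleWord.of_suffix {ω σ : List B} (h : SimpleWord M J ω) (hσ : σ <:+ ω) (hne : σ ≠ []) :
    SimpleWord M J σ := by
  induction h with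
  | single hs =>
    rcases List.suffix_cons_iff.1 hσ with rfl | h
    · exact .single hs
    · exact absurd (List.suffix_nil.1 h) hne
  | cons hr hmem hadj hω h ih =>
    rcases List.suffix_cons_iff.1 hσ with rfl | h'
    · exact .cons hr hmem hadj hω h
    · exact ih h'

/-- A white node adjacent to some letter of a simple word starts a simple word obtained by
prolonging a suffix. -/
theorem SimpleWord.exists_cons_suffix {ω : List B} (h : SimpleWord M J ω) {t : B} (ht : t ∈ J)
    (hmem : t ∉ ω) (hadj : ∃ b ∈ ω, M.coxeterGraph.Adj t b) :
    ∃ σ, σ <:+ ω ∧ SimpleWord M J (t :: σ) := by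
  induction ω with
  | nil => obtain ⟨b, hb, -⟩ := hadj; simp at hb
  | cons a ω ih =>
    by_cases h' : ∃ b ∈ ω, M.coxeterGraph.Adj t b
    · obtain ⟨σ, h1, h2⟩ := ih (h.tail (by rintro rfl; simp at h'))
        (fun h => hmem (List.mem_cons_of_mem _ h)) h'
      exact ⟨σ, h1.trans (List.suffix_cons _ _), h2⟩
    · push Not at h'
      obtain ⟨b, hb, hadj⟩ := hadj
      rcases List.mem_cons.1 hb with rfl | hb
      · exact ⟨_, List.suffix_rfl, .cons ht hmem hadj h' h⟩
      · exact absurd hadj (h' b hb)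

theorem exists_suffix_cons {t : B} {ω : List B} (h : t ∈ ω) : ∃ σ, t :: σ <:+ ω := by
  obtain ⟨l, σ, rfl⟩ := List.append_of_mem h
  exact ⟨σ, l, rfl⟩

/-- Induct along a path from `s` to a black node. At each white node, the word of its successor is
either cut where the node occurs, or cut at the node's last neighbour in it and prolonged by the
node. -/
theorem exists_simpleWord (hM : M.IsIrreducible) (hJ : J ≠ Set.univ) (s : B) :
    ∃ ω, SimpleWord M J (s :: ω) := by
  obtain ⟨b, hb⟩ := (Set.ne_univ_iff_exists_notMem J).1 hJ
  obtain ⟨p⟩ := hM.preconnected s b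
  induction p with
  | nil => exact ⟨[], .single hb⟩
  | @cons t a b hadj p ih =>
    obtain ⟨ω, hω⟩ := ih hb
    by_cases ht : t ∈ J
    · by_cases hmem : t ∈ a :: ω
      · obtain ⟨σ, hσ⟩ := exists_suffix_cons hmem
        exact ⟨σ, hω.of_suffix hσ (by simp)⟩
      · obtain ⟨σ, -, hσ⟩ := hω.exists_cons_suffix ht hmem ⟨a, by simp, hadj⟩
        exact ⟨σ, hσ⟩
    · exact ⟨[], .single ht⟩

/-- Adjacent nodes start simple words one of which prolongs the other, or which agree apart from
the leftmost letter. -/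
theorem exists_simpleWord_of_adj {s t : B} (hadj : M.coxeterGraph.Adj s t)
    (hs : ∃ ω, SimpleWord M J (s :: ω)) (ht : ∃ ω, SimpleWord M J (t :: ω)) :
    ∃ ω, SimpleWord M J (t :: s :: ω) ∨ SimpleWord M J (s :: t :: ω) ∨
      (SimpleWord M J (s :: ω) ∧ SimpleWord M J (t :: ω)) := by
  -- Let `ω` be no longer than any tail for `t`. Then `t` does not occur in `ω`. If `t` is white and
  -- has a neighbour in `ω`, it prolongs a suffix of `ω`, which minimality forces to be `ω`; without
  -- such a neighbour it prolongs `s :: ω`. If `t` is black, then `ω` is empty.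
  have main : ∀ s t : B, M.coxeterGraph.Adj s t → ∀ ω, SimpleWord M J (s :: ω) →
      (∃ ω, SimpleWord M J (t :: ω)) →
      (∀ σ, SimpleWord M J (t :: σ) → ω.length ≤ σ.length) →
      SimpleWord M J (t :: s :: ω) ∨ (SimpleWord M J (s :: ω) ∧ SimpleWord M J (t :: ω)) := by
    intro s t hadj ω hω ⟨τ, hτ⟩ hmin
    by_cases ht : t ∈ J
    · have htω : t ∉ ω := by
        intro hmem
        obtain ⟨σ, hσ⟩ := exists_suffix_cons hmem
        have h1 := hmin σ (hω.of_suffix (hσ.trans (List.suffix_cons _ _)) (by simp))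
        have h2 := hσ.length_le
        simp only [List.length_cons] at h2
        omega
      by_cases h : ∃ b ∈ ω, M.coxeterGraph.Adj t b
      · right
        refine ⟨hω, ?_⟩
        obtain ⟨σ, hσ, h1⟩ := (hω.tail (by rintro rfl; simp at h)).exists_cons_suffix ht htω h
        rwa [hσ.eq_of_length (le_antisymm hσ.length_le (hmin σ h1))] at h1
      · left
        push Not at h
        exact .cons ht (by simp [hadj.ne', htω]) hadj.symm h hω
    · obtain rfl : ω = [] := by
        have := hmin [] (.single ht)
        simpa using this
      exact Or.inr ⟨hω, .single ht⟩
  obtain ⟨ω, hω, hωmin⟩ := exists_minimalFor_of_wellFoundedLT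
    (fun ω => SimpleWord M J (s :: ω)) List.length hs
  obtain ⟨τ, hτ, hτmin⟩ := exists_minimalFor_of_wellFoundedLT
    (fun ω => SimpleWord M J (t :: ω)) List.length ht
  rcases le_total ω.length τ.length with hle | hle
  · refine ⟨ω, (main s t hadj ω hω ht fun σ hσ => ?_).imp id Or.inr⟩
    exact hle.trans ((le_total _ _).elim id (hτmin hσ))
  · refine ⟨τ, Or.inr ((main t s hadj.symm τ hτ hs fun σ hσ => ?_).imp id And.symm)⟩
    exact hle.trans ((le_total _ _).elim id (hωmin hσ))

end Existence

/-! ### The constructed graph is the Coxeter graph -/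

section Graph

namespace MinRep

/-- An element covering two elements with distinct unique left descents `s`, `t` is obtained from
one of them by a left multiplication. -/
theorem eq_or_eq_of_covBy {s t : B} {u v w : cs.MinRep J} (hst : s ≠ t) (huv : u ≠ v)
    (hdu : ∀ q, cs.IsLeftDescent u.1 q ↔ q = s) (hdv : ∀ q, cs.IsLeftDescent v.1 q ↔ q = t)
    (hu : u ⋖ w) (hv : v ⋖ w) : w.1 = cs.simple s * v.1 ∨ w.1 = cs.simple t * u.1 := by
  obtain ⟨r, hr⟩ := cs.exists_leftDescent_of_ne_one (w := w.1) (by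
    intro h
    have := length_lt hu.lt
    rw [h, length_one] at this
    omega)
  have key : ∀ x : cs.MinRep J, x ⋖ w → ¬ cs.IsLeftDescent x.1 r →
      w.1 = cs.simple r * x.1 := by
    intro x hx hxr
    have h1 : x ≤ w.descend hr := BruhatLE.le_simple_mul hx.le hxr
    have h2 : x = w.descend hr :=
      eq_of_le_of_not_lt h1 fun h => hx.2 h (w.descend_covBy hr).lt
    rw [h2]
    exact (cs.simple_mul_simple_cancel_left r).symm
  by_cases hrs : r = s
  · subst hrs
    exact Or.inl (key v hv (by rw [hdv]; exact hst))
  · by_cases hrt : r = t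
    · subst hrt
      exact Or.inr (key u hu (by rwa [hdu]))
    · have h1 := key u hu (by rwa [hdu])
      have h2 := key v hv (by rwa [hdv])
      exact absurd (Subtype.ext (mul_left_cancel (h1.symm.trans h2))) huv

/-- With `x` the common tail, the upper covers are `s t x` and `t s x`. They lie in `W^J` since `s`
and `t` do not commute, and differ for the same reason. -/
theorem encard_upper_covers_of_adj {s t : B} {ω : List B} (hs : SimpleWord M J (s :: ω))
    (ht : SimpleWord M J (t :: ω)) (hadj : M.coxeterGraph.Adj s t) {u v : cs.MinRep J}
    (hu : u.1 = cs.wordProd (s :: ω)) (hv : v.1 = cs.wordProd (t :: ω)) :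
    {w : cs.MinRep J | u ⋖ w ∧ v ⋖ w}.encard = 2 := by
  have main : ∀ s t : B, SimpleWord M J (s :: ω) → SimpleWord M J (t :: ω) →
      M.coxeterGraph.Adj s t → ∀ u v : cs.MinRep J, u.1 = cs.wordProd (s :: ω) →
      v.1 = cs.wordProd (t :: ω) →
      ∃ w : cs.MinRep J, u ⋖ w ∧ v ⋖ w ∧ w.1 = cs.simple s * v.1 := by
    intro s t hs ht hadj u v hu hv
    have hnd : (s :: t :: ω).Nodup := by
      refine List.nodup_cons.2 ⟨?_, ht.nodup⟩
      simp [hadj.ne, (List.nodup_cons.1 hs.nodup).1]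
    have hm : cs.IsMinRep J (cs.simple s * v.1) := by
      by_contra hn
      obtain ⟨j, hj, e⟩ := IsMinRep.exists_simple_mul_eq v.2 hn
      rw [hv] at e
      obtain rfl := cs.eq_of_simple_mul_eq_mul_simple
        (cs.wordProd_mem_parabolic (I := {b | b ∈ t :: ω}) fun _ h => h)
        (List.nodup_cons.1 hnd).1 e
      exact cs.not_adj_of_simple_mul_wordProd_comm hnd e t (by simp) hadj
    have hl : cs.length (cs.simple s * v.1) = ω.length + 2 := by
      rw [hv, ← wordProd_cons, cs.length_wordProd_of_nodup hnd]
      rfl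
    have hlu : cs.length u.1 = ω.length + 1 := by
      rw [hu, cs.length_wordProd_of_nodup hs.nodup]; rfl
    have hlv : cs.length v.1 = ω.length + 1 := by
      rw [hv, cs.length_wordProd_of_nodup ht.nodup]; rfl
    refine ⟨ofIsMinRep _ hm, covBy_of_length ?_ ?_, covBy_of_length ?_ ?_, rfl⟩
    · rw [le_iff, ofIsMinRep_val, hu, wordProd_cons, hv]
      have h1 := simple_mul_bruhatLE (cs.isLeftDescent_wordProd_cons ht.nodup)
      rw [wordProd_cons, simple_mul_simple_cancel_left, ← wordProd_cons] at h1
      exact h1.simple_mul_le_simple_mul' fun hd => by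
        unfold IsLeftDescent at hd
        rw [← hv] at hd
        omega
    · rw [ofIsMinRep_val]; omega
    · exact bruhatLE_simple_mul (by omega)
    · rw [ofIsMinRep_val]; omega
  obtain ⟨w₁, h1, h2, e1⟩ := main s t hs ht hadj u v hu hv
  obtain ⟨w₂, h3, h4, e2⟩ := main t s ht hs hadj.symm v u hv hu
  have huv : u ≠ v := by
    rintro rfl
    rw [hu, wordProd_cons, wordProd_cons] at hv
    exact hadj.ne (cs.simple_injective (mul_right_cancel hv))
  have hne : w₁ ≠ w₂ := by
    rintro rfl
    rw [e1, hu, hv, wordProd_cons, wordProd_cons, ← mul_assoc, ← mul_assoc] at e2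
    exact cs.simple_mul_simple_ne_of_adj hadj (mul_right_cancel e2)
  have : {w : cs.MinRep J | u ⋖ w ∧ v ⋖ w} = {w₁, w₂} := by
    ext w
    constructor
    · rintro ⟨hw, hw'⟩
      rcases eq_or_eq_of_covBy hadj.ne huv (isLeftDescent_iff_eq_head hs hu)
        (isLeftDescent_iff_eq_head ht hv) hw hw' with e | e
      · exact Or.inl (Subtype.ext (e.trans e1.symm))
      · exact Or.inr (Subtype.ext (e.trans e2.symm))
    · rintro (rfl | rfl)
      · exact ⟨h1, h2⟩
      · exact ⟨h4, h3⟩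
  rw [this, Set.encard_pair hne]

/-- The only candidates `s t x` and `t s x` coincide. -/
theorem encard_upper_covers_of_not_adj {s t : B} {u v x : cs.MinRep J} (hst : s ≠ t)
    (hu : u.1 = cs.simple s * x.1) (hv : v.1 = cs.simple t * x.1)
    (hdu : ∀ q, cs.IsLeftDescent u.1 q ↔ q = s) (hdv : ∀ q, cs.IsLeftDescent v.1 q ↔ q = t)
    (hadj : ¬ M.coxeterGraph.Adj s t) : {w : cs.MinRep J | u ⋖ w ∧ v ⋖ w}.encard ≤ 1 := by
  have huv : u ≠ v := by
    rintro rfl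
    rw [hu] at hv
    exact hst (cs.simple_injective (mul_right_cancel hv))
  have key : ∀ w : cs.MinRep J, u ⋖ w → v ⋖ w → w.1 = cs.simple s * cs.simple t * x.1 := by
    intro w hw hw'
    rcases eq_or_eq_of_covBy hst huv hdu hdv hw hw' with e | e
    · rw [e, hv, mul_assoc]
    · rw [e, hu, cs.simple_mul_simple_comm_of_not_adj hadj, mul_assoc]
  rw [Set.encard_le_one_iff]
  rintro a b ⟨ha, ha'⟩ ⟨hb, hb'⟩
  exact Subtype.ext ((key a ha ha').trans (key b hb hb').symm)

theorem chainGraph_adj_iff (hM : M.SimplyLaced) (hirr : M.IsIrreducible) (hJ : J ≠ Set.univ)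
    (U V : ChainNode (cs.MinRep J)) :
    M.coxeterGraph.Adj (nodeHead hM U) (nodeHead hM V) ↔ (chainGraph (cs.MinRep J)).Adj U V := by
  have hmk : ∀ {s : B} {ω : List B} (h : SimpleWord M J (s :: ω)) (U : ChainNode (cs.MinRep J)),
      nodeHead hM U = s → Quot.mk _ (ofSimpleWord cs h) = U := fun h U hU =>
    nodeHead_injective hM ((head_ofSimpleWord hM h).trans hU.symm)
  constructor
  · intro hadj
    refine ⟨fun h => hadj.ne (congrArg _ h), ?_⟩
    obtain ⟨ω, h | h | ⟨h, h'⟩⟩ := exists_simpleWord_of_adj hadj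
      (exists_simpleWord hirr hJ _) (exists_simpleWord hirr hJ _)
    · exact ⟨ofSimpleWord cs (h.tail (by simp)), ofSimpleWord cs h, hmk _ _ rfl, hmk _ _ rfl,
        Or.inl ((h.covBy_iff rfl _).2 rfl)⟩
    · exact ⟨ofSimpleWord cs h, ofSimpleWord cs (h.tail (by simp)), hmk _ _ rfl, hmk _ _ rfl,
        Or.inr (Or.inl ((h.covBy_iff rfl _).2 rfl))⟩
    · exact ⟨ofSimpleWord cs h, ofSimpleWord cs h', hmk _ _ rfl, hmk _ _ rfl,
        Or.inr (Or.inr ⟨⟨ofIsMinRep _ (h.tail_isMinRep cs), (h.covBy_iff rfl _).2 rfl,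
          (h'.covBy_iff rfl _).2 rfl⟩, encard_upper_covers_of_adj h h' hadj rfl rfl⟩)⟩
  · rintro ⟨hne, u, v, rfl, rfl, h⟩
    have hst : head hM u ≠ head hM v := fun h => hne (nodeHead_injective hM h)
    rw [nodeHead_mk, nodeHead_mk]
    have cover : ∀ u v : Chainlikes (cs.MinRep J), u.1 ⋖ v.1 →
        M.coxeterGraph.Adj (head hM v) (head hM u) := by
      intro u v h
      obtain ⟨ω, hω, hv⟩ := exists_simpleWord_head hM v
      have h1 := (hω.covBy_iff hv _).1 h
      generalize head hM v = t at hω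
      cases hω with
      | single ht =>
        -- A one-letter word would give `u = 1`, which is not the product of a simple word.
        obtain ⟨σ, hσ, hu⟩ := exists_simpleWord_head hM u
        have h2 := cs.length_wordProd_of_nodup hσ.nodup
        rw [← hu, h1] at h2
        simp at h2
      | cons hr hmem hadj hω h' => rwa [head_eq hM h' h1]
    rcases h with h | h | ⟨⟨x, hxu, hxv⟩, h⟩
    · exact (cover u v h).symm
    · exact cover v u h
    · by_contra hadj
      obtain ⟨ω, hω, hu⟩ := exists_simpleWord_head hM u
      obtain ⟨ω', hω', hv⟩ := exists_simpleWord_head hM v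
      have := encard_upper_covers_of_not_adj (x := x) hst
        (by rw [(hω.covBy_iff hu _).1 hxu, hu, wordProd_cons])
        (by rw [(hω'.covBy_iff hv _).1 hxv, hv, wordProd_cons])
        (isLeftDescent_iff_eq_head hω hu) (isLeftDescent_iff_eq_head hω' hv) hadj
      rw [h] at this
      exact absurd this (by norm_num)

theorem nodeHead_bijective (hM : M.SimplyLaced) (hirr : M.IsIrreducible) (hJ : J ≠ Set.univ) :
    Function.Bijective (nodeHead (cs := cs) (J := J) hM) := by
  refine ⟨nodeHead_injective hM, fun s => ?_⟩
  obtain ⟨ω, hω⟩ := exists_simpleWord hirr hJ s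
  exact ⟨Quot.mk _ (ofSimpleWord cs hω), head_ofSimpleWord hM hω⟩

/-- The constructed graph is isomorphic to the Coxeter graph, by the leftmost generator. -/
noncomputable def chainGraphIso (hM : M.SimplyLaced) (hirr : M.IsIrreducible)
    (hJ : J ≠ Set.univ) : chainGraph (cs.MinRep J) ≃g M.coxeterGraph where
  toEquiv := Equiv.ofBijective _ (nodeHead_bijective hM hirr hJ)
  map_rel_iff' := by
    intro U V
    exact chainGraph_adj_iff hM hirr hJ U V

/-- The height is the number of letters, and a simple word has just one letter exactly when its
leftmost letter is outside `J`. -/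
theorem isBlack_iff (hM : M.SimplyLaced) (U : ChainNode (cs.MinRep J)) :
    U.IsBlack ↔ nodeHead hM U ∉ J := by
  constructor
  · rintro ⟨u, rfl, hu⟩
    rw [nodeHead_mk]
    obtain ⟨ω, hω, e⟩ := exists_simpleWord_head hM u
    rw [height_eq_length, e, cs.length_wordProd_of_nodup hω.nodup] at hu
    generalize head hM u = s at hω
    cases hω with
    | single hs => exact hs
    | cons hr hmem hadj hω h =>
      simp only [List.length_cons] at hu
      norm_cast at hu
      omega
  · obtain ⟨u⟩ := U
    intro h
    obtain ⟨ω, hω, e⟩ := exists_simpleWord_head hM u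
    refine ⟨u, rfl, ?_⟩
    rw [height_eq_length, e, cs.length_wordProd_of_nodup hω.nodup, hω.eq_nil h]
    rfl

end MinRep

end Graph

end CoxeterSystem

theorem mainTheorem9 {B W : Type*} [Finite B] [Group W] {M : CoxeterMatrix B}
    (cs : CoxeterSystem M W) (J : Set B) :
    -- the length function on `W^J` is determined by the order
    (∀ w : cs.MinRep J, Order.height w = (cs.length w.1 : ℕ∞)) ∧
    -- simple elements are chainlike, for every Coxeter system
    (∀ w : cs.MinRep J, w.IsSimple → IsChainlike w) ∧
    (M.SimplyLaced →
      (∀ w : cs.MinRep J, w.IsSimple ↔ IsChainlike w) ∧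
      Equivalence (ChainSim (P := cs.MinRep J)) ∧
      (M.IsIrreducible → J ≠ Set.univ →
        -- an isomorphism of graphs that preserves the colours and sends the class of a
        -- chainlike element to its leftmost generator
        ∃ φ : chainGraph (cs.MinRep J) ≃g M.coxeterGraph,
          (∀ U : ChainNode (cs.MinRep J), U.IsBlack ↔ φ U ∉ J) ∧
          (∀ u : Chainlikes (cs.MinRep J), ∃ u' : cs.MinRep J,
            u' ⋖ u.1 ∧ u.1.1 = cs.simple (φ (Quot.mk _ u)) * u'.1))) := by
  refine ⟨CoxeterSystem.MinRep.height_eq_length, fun w hw => hw.isChainlike, fun hM =>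
    ⟨CoxeterSystem.MinRep.isSimple_iff_isChainlike hM, CoxeterSystem.MinRep.chainSim_equivalence hM, fun hirr hJ =>
      ⟨CoxeterSystem.MinRep.chainGraphIso hM hirr hJ, CoxeterSystem.MinRep.isBlack_iff hM, fun u => ?_⟩⟩⟩
  obtain ⟨ω, hω, hu⟩ := CoxeterSystem.MinRep.exists_simpleWord_head hM u
  refine ⟨CoxeterSystem.MinRep.ofIsMinRep _ (hω.tail_isMinRep cs), (hω.covBy_iff hu _).2 rfl, ?_⟩
  rw [CoxeterSystem.MinRep.ofIsMinRep_val, hu, CoxeterSystem.wordProd_cons]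
  rfl
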